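/- For $A\subseteq\mathbb N$ and real $x\ge 1$ let $R_x(A):=1-\frac{\#(A\cap[1,x])}{x}$, and let $A\cdot A:=\{mn : m,n\in A\}$. For $a>0$ let $$\psi(a):=\sup\Big\{b>0 \;\Big|\; R_x(A\cdot A)\ll(\log x)^{-b}\ \text{ for all } A\subseteq\mathbb N \text{ with } R_x(A)\ll(\log x)^{-a}\Big\},$$ where all asymptotic relations are as $x\to\infty$, with implied constants that may depend on $A$ and on the exponents; $f=\Omega(g)$ means that there is $c>0$ such that $|f(x)|\ge c|g(x)|$ for arbitrarily large $x$. Let $\phi(x):=x\log x-x+1$ for $x>0$ and $\phi(0):=1$. The function $\phi$ is a decreasing bijection of $[0,1]$ onto itself, and $\phi^{-1}:[0,1]\to[0,1]$ denotes the inverse of this bijection. For $a\in(0,1/4)$ and $B\in[0,\phi^{-1}(4a)]$ let $$W(a,B):=\frac{\big(\phi(B)-\sqrt{\phi(B)^2-4a\,\phi(B)}\big)^2}{4\phi(B)}+a\,\frac{\phi(2B)}{\phi(B)},\qquad K(a):=\min_{B\in[0,\phi^{-1}(4a)]}W(a,B).$$ **Theorem.** For $a\in(0,1/4)$ the minimum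 defining $K(a)$ exists, and $$\psi(a)\le K(a).$$ Equivalently, for every $a\in(0,1/4)$ and every $\varepsilon>0$ there is a set $A\subseteq\mathbb N$ of natural density $1$ with $R_x(A)\ll(\log x)^{-a}$ and $R_x(A\cdot A)=\Omega\big((\log x)^{-K(a)-\varepsilon}\big)$. Moreover, $$K(a)<a\quad\text{for } a\in(0,\,0.11717],\qquad\text{and}\qquad K(a)\le\frac{2a^2}{1-\log 2}+o(a^2)\quad\text{as } a\to0^+.$$ -/

import Mathlib

open Filter Asymptotics Set
open scoped Topology Pointwise

namespace ProductSetDensity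

noncomputable section

/-- The relative defect `R_x(A) = 1 - #(A ∩ [1, x]) / x` of a set of natural numbers. -/
def R (x : ℝ) (A : Set ℕ) : ℝ :=
  1 - ({n : ℕ | n ∈ A ∧ 1 ≤ n ∧ (n : ℝ) ≤ x}.ncard : ℝ) / x

/-- `f = Ω(g)` as `x → ∞`: for some `c > 0`, `|f x| ≥ c |g x|` for arbitrarily large `x`. -/
def IsOmega (f g : ℝ → ℝ) : Prop :=
  ∃ c : ℝ, 0 < c ∧ ∃ᶠ x in atTop, c * |g x| ≤ |f x|

/-- The supremum of the admissible exponents `b > 0`, those for which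
`R_x(A) ≪ (log x)^{-a}` implies `R_x(A·A) ≪ (log x)^{-b}` for every `A ⊆ ℕ`.
The supremum is taken in the extended reals, so that an unbounded set of exponents gives `⊤`. -/
def psi (a : ℝ) : EReal :=
  sSup ((fun b : ℝ => (b : EReal)) '' {b : ℝ | 0 < b ∧ ∀ A : Set ℕ,
    (fun x : ℝ => R x A) =O[atTop] (fun x : ℝ => (Real.log x) ^ (-a)) →
    (fun x : ℝ => R x (A * A)) =O[atTop] (fun x : ℝ => (Real.log x) ^ (-b))})

/-- `φ(x) = x log x - x + 1`; since `Real.log 0 = 0`, the value at `0` is `1`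
(see `phi_zero`). -/
def phi (x : ℝ) : ℝ := x * Real.log x - x + 1

theorem phi_zero : phi 0 = 1 := by simp [phi]

theorem phi_one : phi 1 = 0 := by simp [phi]

theorem phi_continuous : Continuous phi := by
  unfold phi
  exact (Real.continuous_mul_log.sub continuous_id).add continuous_const

theorem phi_strictAntiOn : StrictAntiOn phi (Icc 0 1) := by
  refine strictAntiOn_of_deriv_neg (convex_Icc 0 1) phi_continuous.continuousOn ?_
  intro x hx
  rw [interior_Icc] at hx
  have h : HasDerivAt phi (Real.log x) x := by
    have h1 := ((Real.hasDerivAt_mul_log hx.1.ne').sub (hasDerivAt_id x)).add_const (1 : ℝ)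
    have h2 : Real.log x + 1 - 1 = Real.log x := by ring
    rw [h2] at h1
    exact h1
  rw [h.deriv]
  exact Real.log_neg hx.1 hx.2

/-- `φ` restricts to a (decreasing) bijection of `[0, 1]`, so that `φ⁻¹` makes sense there. -/
theorem phi_bijOn : BijOn phi (Icc 0 1) (Icc 0 1) := by
  refine ⟨?_, phi_strictAntiOn.injOn, ?_⟩
  · intro x hx
    have h0 : (0 : ℝ) ∈ Icc (0 : ℝ) 1 := by simp
    have h1 : (1 : ℝ) ∈ Icc (0 : ℝ) 1 := by simp
    refine ⟨?_, ?_⟩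
    · rw [← phi_one]
      exact phi_strictAntiOn.antitoneOn hx h1 hx.2
    · rw [← phi_zero]
      exact phi_strictAntiOn.antitoneOn h0 hx hx.1
  · have h := intermediate_value_Icc' (zero_le_one (α := ℝ)) phi_continuous.continuousOn
    rw [phi_one, phi_zero] at h
    exact h

/-- The inverse of the bijection `φ : [0, 1] → [0, 1]`. -/
def phiInv : ℝ → ℝ := Function.invFunOn phi (Icc 0 1)

theorem phiInv_mem {y : ℝ} (hy : y ∈ Icc (0 : ℝ) 1) : phiInv y ∈ Icc (0 : ℝ) 1 :=
  Function.invFunOn_mem (phi_bijOn.surjOn hy)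

theorem phi_phiInv {y : ℝ} (hy : y ∈ Icc (0 : ℝ) 1) : phi (phiInv y) = y :=
  Function.invFunOn_eq (phi_bijOn.surjOn hy)

/-- The quantity to be minimised. -/
def W (a B : ℝ) : ℝ :=
  (phi B - Real.sqrt (phi B ^ 2 - 4 * a * phi B)) ^ 2 / (4 * phi B) + a * (phi (2 * B) / phi B)

/-- The minimum of `W a B` over `B ∈ [0, φ⁻¹(4a)]`. -/
def K (a : ℝ) : ℝ := sInf (W a '' Icc 0 (phiInv (4 * a)))

end

end ProductSetDensity

namespace ProductSetDensity

/-! ### Mertens' estimates -/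

/-! Fix `B` with φ(B) ≥ 4a and put r = a/φ(B) ≤ 1/4. At a scale X = exp(exp L), remove the integers
in (exp exp(r^M L), X] which for every 1 ≤ i ≤ M have at most B r^i L prime factors up to exp
exp(r^i L), where a typical integer has about r^i L. By Rankin's trick, condition i+1 alone holds
for a proportion ≪ exp(-φ(B) r^(i+1) L) = exp(-a r^i L) of the integers up to N, and this is ≪ (log
N)^(-a) as long as N ≤ exp exp(r^i L). The geometric scales therefore cover all N, each range being
served by the next smaller scale (`exists_card_removed_le`). Taking a rapidly growing sequence of L
and deleting all removed sets together with 1 leaves a set A with defect ≪ (log x)^(-a).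

The gaps of A·A come from a pigeonhole argument. Let N ≤ X have no prime factor up to exp exp(r^M
L), the full permitted proportion B of primes in each lower window, and twice that proportion in the
top window (exp exp(r² L), exp exp(r L)]. If N = mn with m, n ≥ 2, one factor receives at most half
of the primes in the top window, so it meets every condition and was removed; hence N ∉ A·A
(`mem_removed_of_mul`). In a window of log-log length δL, having βδL primes has Poisson probability
about exp(-φ(β)δL). Such N thus have proportion about exp(-(φ(B) r² + φ(2B)(r - r²))L), up to an
arbitrarily small loss in the exponent when M is large. The lower bound is constructive
(`eventually_exists_windowed`): start from rough integers with logarithmic weights, multiply by the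
window primes, and finish with one large prime, which turns logarithmic weights into a count.

The exponent obtained is at most W(a, B) (`le_W`); a minimiser B gives the bound K(a). The two
estimates for K come from the test values B = 4/33 and B = 1/2. -/

theorem summable_log_div : Summable (fun n : ℕ => Real.log n / (n * (n - 1 : ℝ))) := by
  have hs : Summable (fun n : ℕ => 4 * (1 / (n : ℝ) ^ (3 / 2 : ℝ))) :=
    (Real.summable_one_div_nat_rpow.mpr (by norm_num)).mul_left 4
  refine Summable.of_nonneg_of_le (fun n => ?_) (fun n => ?_) hs
  · rcases Nat.eq_zero_or_pos n with rfl | hn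
    · simp
    · have : (1 : ℝ) ≤ n := by exact_mod_cast hn
      exact div_nonneg (Real.log_nonneg this) (mul_nonneg (by linarith) (by linarith))
  · rcases lt_or_ge n 2 with hn | hn
    · interval_cases n <;> simp
    · have h2 : (2 : ℝ) ≤ n := by exact_mod_cast hn
      have h0 : (0 : ℝ) < n := by linarith
      have hlog : Real.log n ≤ 2 * (n : ℝ) ^ (1 / 2 : ℝ) := by
        have := Real.log_le_rpow_div h0.le (ε := 1 / 2) (by norm_num)
        linarith
      have hpow : (n : ℝ) ^ (1 / 2 : ℝ) * (n : ℝ) ^ (3 / 2 : ℝ) = (n : ℝ) ^ 2 := by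
        rw [← Real.rpow_add h0]; norm_num
      have hp : 0 < (n : ℝ) ^ (3 / 2 : ℝ) := Real.rpow_pos_of_pos h0 _
      rw [mul_one_div, div_le_div_iff₀ (mul_pos h0 (by linarith)) hp]
      calc Real.log n * (n : ℝ) ^ (3 / 2 : ℝ) ≤ 2 * (n : ℝ) ^ (1 / 2 : ℝ) * (n : ℝ) ^ (3 / 2 : ℝ) := by
            gcongr
        _ = 2 * (n : ℝ) ^ 2 := by rw [mul_assoc, hpow]
        _ ≤ 4 * (n * (n - 1)) := by nlinarith

theorem log_factorial_eq (N : ℕ) : Real.log (N.factorial : ℝ) =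
    ∑ p ∈ (Finset.Icc 1 N).filter Nat.Prime, (N.factorial.factorization p : ℝ) * Real.log p := by
  have h := Nat.prod_factorization_pow_eq_self (Nat.factorial_ne_zero N)
  conv_lhs => rw [← h]
  rw [Finsupp.prod, Nat.cast_prod, Real.log_prod]
  · rw [Nat.support_factorization]
    have hsub : N.factorial.primeFactors = (Finset.Icc 1 N).filter Nat.Prime := by
      ext p
      simp only [Nat.mem_primeFactors, Finset.mem_filter, Finset.mem_Icc]
      constructor
      · rintro ⟨hp, hd, -⟩
        exact ⟨⟨hp.one_le, (hp.dvd_factorial).1 hd⟩, hp⟩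
      · rintro ⟨⟨-, hN⟩, hp⟩
        exact ⟨hp, (hp.dvd_factorial).2 hN, Nat.factorial_ne_zero N⟩
    rw [hsub]
    refine Finset.sum_congr rfl fun p _ => ?_
    push_cast
    rw [Real.log_pow]
  · intro p hp
    have : p.Prime := Nat.prime_of_mem_primeFactors (by simpa using hp)
    have := this.pos
    positivity

/-- Legendre's formula: (p-1) v_p(N!) equals N minus the base-p digit sum of N, and the digit sum is
dropped. -/
theorem factorization_factorial_le {N p : ℕ} (hp : p.Prime) :
    (N.factorial.factorization p : ℝ) ≤ N / (p - 1 : ℝ) := by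
  have : Fact p.Prime := ⟨hp⟩
  have h := sub_one_mul_padicValNat_factorial (p := p) N
  rw [Nat.factorization_def _ hp]
  have h2 : (p - 1) * padicValNat p N.factorial ≤ N := by rw [h]; exact Nat.sub_le _ _
  have h3 : ((p : ℝ) - 1) * padicValNat p N.factorial ≤ N := by
    have h4 : (((p - 1) * padicValNat p N.factorial : ℕ) : ℝ) ≤ N := by exact_mod_cast h2
    rwa [Nat.cast_mul, Nat.cast_sub hp.one_le, Nat.cast_one] at h4
  have h5 : (0 : ℝ) < p - 1 := by
    have : (2 : ℝ) ≤ p := by exact_mod_cast hp.two_le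
    linarith
  rw [le_div_iff₀ h5]
  linarith

theorem le_factorization_factorial {N p : ℕ} (hp : p.Prime) :
    (N / p : ℝ) - 1 ≤ N.factorial.factorization p := by
  have h1 : (p * (N / p)).factorial.factorization p ≤ N.factorial.factorization p :=
    (Nat.factorization_le_iff_dvd (Nat.factorial_ne_zero _) (Nat.factorial_ne_zero _)).2
      (Nat.factorial_dvd_factorial (Nat.mul_div_le N p)) p
  rw [Nat.factorization_factorial_mul hp] at h1
  have h2 : N / p ≤ N.factorial.factorization p := by omega
  have h3 : (N / p : ℝ) < (N / p : ℕ) + 1 := by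
    rw [div_lt_iff₀ (by exact_mod_cast hp.pos)]
    exact_mod_cast (by linarith [Nat.lt_div_mul_add (a := N) hp.pos] : N < (N / p + 1) * p)
  have h4 : ((N / p : ℕ) : ℝ) ≤ N.factorial.factorization p := by exact_mod_cast h2
  linarith

/-- One half of Mertens' first theorem, from log N! ≤ N log N and v_p(N!) ≥ N/p - 1; the resulting
loss Σ log p is absorbed by θ(N) ≤ N log 4. -/
theorem sum_log_div_le {N : ℕ} (hN : 1 ≤ N) :
    ∑ p ∈ (Finset.Icc 1 N).filter Nat.Prime, Real.log p / p ≤ Real.log N + Real.log 4 := by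
  have hN0 : (0 : ℝ) < N := by exact_mod_cast hN
  have h1 : ∑ p ∈ (Finset.Icc 1 N).filter Nat.Prime, ((N / p : ℝ) - 1) * Real.log p ≤
      Real.log (N.factorial : ℝ) := by
    rw [log_factorial_eq]
    refine Finset.sum_le_sum fun p hp => ?_
    have hp' := (Finset.mem_filter.1 hp).2
    exact mul_le_mul_of_nonneg_right (le_factorization_factorial hp')
      (Real.log_nonneg (by exact_mod_cast hp'.one_le))
  have h2 : Real.log (N.factorial : ℝ) ≤ N * Real.log N := by
    rw [← Real.log_pow]
    apply Real.log_le_log (by exact_mod_cast Nat.factorial_pos N)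
    exact_mod_cast Nat.factorial_le_pow N
  have h3 : ∑ p ∈ (Finset.Icc 1 N).filter Nat.Prime, Real.log p ≤ Real.log 4 * N := by
    have := Chebyshev.theta_le_log4_mul_x (x := N) hN0.le
    rw [Chebyshev.theta_eq_sum_Icc] at this
    simp only [Nat.floor_natCast] at this
    refine le_trans (Finset.sum_le_sum_of_subset_of_nonneg ?_ ?_) this
    · intro p
      simp only [Finset.mem_filter, Finset.mem_Icc]
      exact fun h => ⟨⟨Nat.zero_le _, h.1.2⟩, h.2⟩
    · intro p _ _
      exact Real.log_natCast_nonneg p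
  have h4 : ∑ p ∈ (Finset.Icc 1 N).filter Nat.Prime, ((N / p : ℝ) - 1) * Real.log p =
      N * ∑ p ∈ (Finset.Icc 1 N).filter Nat.Prime, Real.log p / p -
      ∑ p ∈ (Finset.Icc 1 N).filter Nat.Prime, Real.log p := by
    rw [Finset.mul_sum, ← Finset.sum_sub_distrib]
    refine Finset.sum_congr rfl fun p _ => ?_
    ring
  have h5 : (N : ℝ) * ∑ p ∈ (Finset.Icc 1 N).filter Nat.Prime, Real.log p / p ≤
      N * (Real.log N + Real.log 4) := by linarith
  exact le_of_mul_le_mul_left h5 hN0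

/-- The other half: N/(p-1) = N/p + N/(p(p-1)), and the second terms contribute only a convergent
series. -/
theorem le_sum_log_div {N : ℕ} (hN : 1 ≤ N) :
    Real.log N - 1 - ∑' n : ℕ, Real.log n / (n * (n - 1 : ℝ)) ≤
    ∑ p ∈ (Finset.Icc 1 N).filter Nat.Prime, Real.log p / p := by
  have hN0 : (0 : ℝ) < N := by exact_mod_cast hN
  have h1 : Real.log (N.factorial : ℝ) ≤
      ∑ p ∈ (Finset.Icc 1 N).filter Nat.Prime, (N / (p - 1 : ℝ)) * Real.log p := by
    rw [log_factorial_eq]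
    refine Finset.sum_le_sum fun p hp => ?_
    have hp' := (Finset.mem_filter.1 hp).2
    exact mul_le_mul_of_nonneg_right (factorization_factorial_le hp')
      (Real.log_nonneg (by exact_mod_cast hp'.one_le))
  have h2 : N * Real.log N - N ≤ Real.log (N.factorial : ℝ) := by
    have h1 := Stirling.le_log_factorial_stirling (n := N) (by omega)
    have h2 : 0 ≤ Real.log N := Real.log_natCast_nonneg N
    have h3 : 0 ≤ Real.log (2 * Real.pi) := Real.log_nonneg (by linarith [Real.pi_gt_three])
    linarith
  have h4 : ∑ p ∈ (Finset.Icc 1 N).filter Nat.Prime, (N / (p - 1 : ℝ)) * Real.log p =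
      N * (∑ p ∈ (Finset.Icc 1 N).filter Nat.Prime, Real.log p / p +
      ∑ p ∈ (Finset.Icc 1 N).filter Nat.Prime, Real.log p / (p * (p - 1 : ℝ))) := by
    rw [← Finset.sum_add_distrib, Finset.mul_sum]
    refine Finset.sum_congr rfl fun p hp => ?_
    have hp' := (Finset.mem_filter.1 hp).2
    have h2 : (2 : ℝ) ≤ p := by exact_mod_cast hp'.two_le
    have h3 : (p : ℝ) - 1 ≠ 0 := by linarith
    have h4 : (p : ℝ) ≠ 0 := by linarith
    field_simp
    ring
  have h5 : ∑ p ∈ (Finset.Icc 1 N).filter Nat.Prime, Real.log p / (p * (p - 1 : ℝ)) ≤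
      ∑' n : ℕ, Real.log n / (n * (n - 1 : ℝ)) := by
    refine summable_log_div.sum_le_tsum _ fun n _ => ?_
    rcases Nat.eq_zero_or_pos n with rfl | hn
    · simp
    · have : (1 : ℝ) ≤ n := by exact_mod_cast hn
      exact div_nonneg (Real.log_nonneg this) (mul_nonneg (by linarith) (by linarith))
  have h6 : (N : ℝ) * (Real.log N - 1) ≤
      N * (∑ p ∈ (Finset.Icc 1 N).filter Nat.Prime, Real.log p / p +
      ∑' n : ℕ, Real.log n / (n * (n - 1 : ℝ))) := by
    have := mul_le_mul_of_nonneg_left h5 hN0.le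
    rw [mul_add] at h4 ⊢
    linarith
  have := le_of_mul_le_mul_left h6 hN0
  linarith

/-- Abel summation: the increments of a bounded sequence are summed against a nonnegative decreasing
weight. -/
theorem abs_sum_mul_le {E w : ℕ → ℝ} {K : ℝ} (hE : ∀ n, |E n| ≤ K) {u : ℕ}
    (hw : ∀ n, u < n → w (n + 1) ≤ w n) (hw0 : ∀ n, u < n → 0 ≤ w n) {v : ℕ} (huv : u < v) :
    |∑ n ∈ Finset.Ioc u v, (E n - E (n - 1)) * w n| ≤ 2 * K * w (u + 1) := by
  -- The boundary term E v · w v is kept apart, so that each induction step adds only E v (w v - w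
  -- (v+1)), whose bound telescopes.
  have key : |∑ n ∈ Finset.Ioc u v, (E n - E (n - 1)) * w n - E v * w v| ≤
      K * (2 * w (u + 1) - w v) := by
    induction v, huv using Nat.le_induction with
    | base =>
      rw [Nat.succ_eq_add_one, Finset.sum_Ioc_succ_top le_rfl]
      simp only [Finset.Ioc_self, Finset.sum_empty, Nat.add_sub_cancel, zero_add]
      have := hE u
      have h0 := hw0 (u + 1) (Nat.lt_succ_self u)
      have : |(E (u + 1) - E u) * w (u + 1) - E (u + 1) * w (u + 1)| = |E u| * w (u + 1) := by
        rw [← abs_of_nonneg h0, ← abs_mul, ← abs_neg (E u * _), abs_of_nonneg h0]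
        congr 1; ring
      rw [this]
      nlinarith [hE u]
    | succ v hv ih =>
      rw [Finset.sum_Ioc_succ_top (by omega), Nat.add_sub_cancel]
      have h1 := hw v hv
      have h2 : |E v * (w v - w (v + 1))| ≤ K * (w v - w (v + 1)) := by
        rw [abs_mul, abs_of_nonneg (sub_nonneg.2 h1)]
        exact mul_le_mul_of_nonneg_right (hE v) (sub_nonneg.2 h1)
      rw [abs_le] at *
      constructor <;> nlinarith [h2.1, h2.2, ih.1, ih.2]
  have h0 := hw0 v huv
  have h2 : |E v * w v| ≤ K * w v := by
    rw [abs_mul, abs_of_nonneg h0]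
    exact mul_le_mul_of_nonneg_right (hE v) h0
  rw [abs_le] at *
  constructor <;> nlinarith [h2.1, h2.2, key.1, key.2]

theorem log_log_succ_sub_le {n : ℕ} (hn : 2 ≤ n) :
    Real.log (Real.log (n + 1 : ℕ)) - Real.log (Real.log n) ≤ 1 / (n * Real.log n) := by
  have h2 : (2 : ℝ) ≤ n := by exact_mod_cast hn
  have hl : 0 < Real.log n := Real.log_pos (by linarith)
  have hl' : 0 < Real.log (n + 1 : ℕ) := Real.log_pos (by push_cast; linarith)
  have h3 : Real.log (n + 1 : ℕ) - Real.log n ≤ 1 / n := by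
    rw [← Real.log_div (by positivity) (by positivity)]
    refine (Real.log_le_sub_one_of_pos (by positivity)).trans (le_of_eq ?_)
    push_cast
    field_simp
    ring
  rw [← Real.log_div hl'.ne' hl.ne']
  refine (Real.log_le_sub_one_of_pos (by positivity)).trans ?_
  rw [div_sub_one hl.ne', ← div_div]
  gcongr

theorem le_log_log_succ_sub {n : ℕ} (hn : 2 ≤ n) :
    1 / ((n + 1 : ℕ) * Real.log (n + 1 : ℕ)) ≤
    Real.log (Real.log (n + 1 : ℕ)) - Real.log (Real.log n) := by
  have h2 : (2 : ℝ) ≤ n := by exact_mod_cast hn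
  have hl : 0 < Real.log n := Real.log_pos (by linarith)
  have hl' : 0 < Real.log (n + 1 : ℕ) := Real.log_pos (by push_cast; linarith)
  have h3 : 1 / ((n + 1 : ℕ) : ℝ) ≤ Real.log (n + 1 : ℕ) - Real.log n := by
    rw [← Real.log_div (by positivity) (by positivity)]
    refine le_trans (le_of_eq ?_) (Real.one_sub_inv_le_log_of_pos (by positivity))
    push_cast
    field_simp
    ring
  rw [← Real.log_div hl'.ne' hl.ne']
  refine le_trans ?_ (Real.one_sub_inv_le_log_of_pos (by positivity))
  rw [inv_div, one_sub_div hl'.ne', ← div_div]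
  gcongr

/-- The sum of reciprocals of the primes in `(u, v]`. -/
noncomputable def primeRecip (u v : ℕ) : ℝ := ∑ p ∈ (Finset.Ioc u v).filter Nat.Prime, 1 / (p : ℝ)

/-- Mertens' second theorem, up to a bounded error. -/
theorem exists_abs_primeRecip_sub_le : ∃ C : ℝ, 0 < C ∧ ∀ u v : ℕ, 2 ≤ u → u ≤ v →
    |primeRecip u v - (Real.log (Real.log v) - Real.log (Real.log u))| ≤ C := by
  set T := ∑' n : ℕ, Real.log n / (n * (n - 1 : ℝ)) with hT
  have hT0 : 0 ≤ T := tsum_nonneg fun n => by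
    rcases Nat.eq_zero_or_pos n with rfl | hn
    · simp
    · have : (1 : ℝ) ≤ n := by exact_mod_cast hn
      exact div_nonneg (Real.log_nonneg this) (mul_nonneg (by linarith) (by linarith))
  -- Primes are compared with the harmonic sum: by Mertens' first theorem the partial sums of `c`
  -- are bounded, and the weight 1/log n turns `c` into 1/p - 1/(n log n).
  set c : ℕ → ℝ := fun n => (if n.Prime then Real.log n / n else 0) - 1 / n with hc
  set E : ℕ → ℝ := fun N => ∑ n ∈ Finset.Icc 1 N, c n with hE
  have hl4 : 0 < Real.log 4 := Real.log_pos (by norm_num)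
  set K : ℝ := 2 + T + Real.log 4 with hK
  have hEK : ∀ N, |E N| ≤ K := by
    intro N
    rcases Nat.eq_zero_or_pos N with rfl | hN
    · simp [hE]; linarith
    · have h1 := sum_log_div_le hN
      have h2 := le_sum_log_div hN
      have hH : ((harmonic N : ℚ) : ℝ) = ∑ n ∈ Finset.Icc 1 N, 1 / (n : ℝ) := by
        rw [harmonic_eq_sum_Icc]; push_cast; simp
      have h3 := harmonic_le_one_add_log N
      have h4 := log_add_one_le_harmonic N
      have h5 : Real.log N ≤ Real.log (N + 1 : ℕ) := by
        apply Real.log_le_log (by exact_mod_cast hN); push_cast; linarith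
      have h6 : E N = ∑ p ∈ (Finset.Icc 1 N).filter Nat.Prime, Real.log p / p -
          ∑ n ∈ Finset.Icc 1 N, 1 / (n : ℝ) := by
        simp only [hE, hc, Finset.sum_sub_distrib, Finset.sum_filter]
      rw [h6, ← hH, abs_le]
      constructor <;> linarith
  refine ⟨2 * K * 1 + 2, by positivity, fun u v hu huv => ?_⟩
  rcases huv.eq_or_lt with rfl | huv
  · simp [primeRecip]; positivity
  have hlog : ∀ n : ℕ, u < n → 1 ≤ Real.log n := fun n hn => by
    have h3 : (3 : ℝ) ≤ n := by exact_mod_cast (by omega : 3 ≤ n)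
    rw [Real.le_log_iff_exp_le (by linarith)]
    linarith [Real.exp_one_lt_d9]
  have hw := abs_sum_mul_le (E := E) (w := fun n => 1 / Real.log n) hEK (u := u)
    (fun n hn => by
      have := hlog n hn
      apply one_div_le_one_div_of_le (by linarith)
      apply Real.log_le_log (by exact_mod_cast (by omega : 0 < n))
      push_cast; linarith)
    (fun n hn => by have := hlog n hn; positivity) huv
  have hw1 : (1 : ℝ) / Real.log (u + 1 : ℕ) ≤ 1 := by
    have := hlog (u + 1) (Nat.lt_succ_self u)
    rw [div_le_one (by linarith)]; exact this
  have hsum : ∑ n ∈ Finset.Ioc u v, (E n - E (n - 1)) * (1 / Real.log n) =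
      primeRecip u v - ∑ n ∈ Finset.Ioc u v, 1 / (n * Real.log n) := by
    rw [primeRecip, Finset.sum_filter, ← Finset.sum_sub_distrib]
    refine Finset.sum_congr rfl fun n hn => ?_
    obtain ⟨hn1, -⟩ := Finset.mem_Ioc.1 hn
    have h1 := hlog n hn1
    have h2 : E n - E (n - 1) = c n := by
      obtain ⟨m, rfl⟩ : ∃ m, n = m + 1 := ⟨n - 1, by omega⟩
      simp only [hE, Nat.add_sub_cancel]
      rw [Finset.sum_Icc_succ_top (by omega)]
      ring
    have hn0 : (n : ℝ) ≠ 0 := by exact_mod_cast (by omega : n ≠ 0)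
    rw [h2]
    simp only [hc]
    split_ifs
    · field_simp
    · field_simp
      ring
  have hup : ∑ n ∈ Finset.Ioc u v, 1 / (n * Real.log n) ≤
      Real.log (Real.log v) - Real.log (Real.log u) := by
    clear hsum hw
    have huv' := huv.le
    clear huv
    induction v, huv' using Nat.le_induction with
    | base => simp
    | succ v hv ih =>
      rcases hv.eq_or_lt with rfl | hv'
      · rw [Finset.sum_Ioc_succ_top (by omega)]
        simpa using le_log_log_succ_sub hu
      · rw [Finset.sum_Ioc_succ_top (by omega)]
        have := le_log_log_succ_sub (hu.trans hv)
        have := ih hv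
        linarith
  have hlow : Real.log (Real.log (v + 1 : ℕ)) - Real.log (Real.log (u + 1 : ℕ)) ≤
      ∑ n ∈ Finset.Ioc u v, 1 / (n * Real.log n) := by
    clear hsum hw hup
    have huv' := huv.le
    clear huv
    induction v, huv' using Nat.le_induction with
    | base => simp
    | succ v hv ih =>
      rcases hv.eq_or_lt with rfl | hv'
      · rw [Finset.sum_Ioc_succ_top (by omega)]
        simpa using log_log_succ_sub_le (n := u + 1) (by omega)
      · rw [Finset.sum_Ioc_succ_top (by omega)]
        have := log_log_succ_sub_le (n := v + 1) (by omega)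
        have := ih hv
        linarith
  have h7 := log_log_succ_sub_le hu
  have h8 : 1 / ((u : ℝ) * Real.log u) ≤ 1 := by
    have h2 : (2 : ℝ) ≤ u := by exact_mod_cast hu
    have : Real.log 2 ≤ Real.log u := Real.log_le_log (by norm_num) h2
    have := Real.log_two_gt_d9
    rw [div_le_one (by nlinarith)]
    nlinarith
  have h9 : Real.log (Real.log v) ≤ Real.log (Real.log (v + 1 : ℕ)) := by
    have := hlog v huv
    apply Real.log_le_log (by linarith)
    apply Real.log_le_log (by exact_mod_cast (by omega : 0 < v))
    push_cast; linarith
  have hK0 : 0 ≤ K := by positivity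
  rw [hsum] at hw
  have hw2 : 2 * K * (1 / Real.log (u + 1 : ℕ)) ≤ 2 * K * 1 := by gcongr
  have hw3 := hw.trans hw2
  rw [abs_le] at hw3 ⊢
  constructor <;> linarith [hw3.1, hw3.2]


/-! ### Numbers with few prime factors in an interval -/

/-- The number of prime factors of `n` in `(u, v]`, counted with multiplicity. -/
def primeCountIn (u v n : ℕ) : ℕ := ∑ p ∈ Finset.Ioc u v, n.factorization p

theorem primeCountIn_mul (u v : ℕ) {m n : ℕ} (hm : m ≠ 0) (hn : n ≠ 0) :
    primeCountIn u v (m * n) = primeCountIn u v m + primeCountIn u v n := by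
  simp [primeCountIn, Nat.factorization_mul hm hn, Finset.sum_add_distrib]

theorem primeCountIn_add {u v w : ℕ} (huv : u ≤ v) (hvw : v ≤ w) (n : ℕ) :
    primeCountIn u v n + primeCountIn v w n = primeCountIn u w n := by
  rw [primeCountIn, primeCountIn, primeCountIn,
    ← Finset.Ioc_union_Ioc_eq_Ioc huv hvw, Finset.sum_union]
  exact Finset.Ioc_disjoint_Ioc_of_le le_rfl

theorem primeCountIn_le_of_dvd (u v : ℕ) {m n : ℕ} (h : m ∣ n) (hn : n ≠ 0) :
    primeCountIn u v m ≤ primeCountIn u v n :=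
  Finset.sum_le_sum fun p _ =>
    (Nat.factorization_le_iff_dvd (ne_zero_of_dvd_ne_zero hn h) hn).2 h p

theorem primeCountIn_prime (u v : ℕ) {p : ℕ} (hp : p.Prime) :
    primeCountIn u v p = if p ∈ Finset.Ioc u v then 1 else 0 := by
  rw [primeCountIn, hp.factorization]
  simp [Finsupp.single_apply]

theorem primeCountIn_one (u v : ℕ) : primeCountIn u v 1 = 0 := by simp [primeCountIn]

theorem one_le_primeCountIn {u v n p : ℕ} (hp : p.Prime) (hn : n ≠ 0) (hd : p ∣ n)
    (hu : u < p) (hv : p ≤ v) : 1 ≤ primeCountIn u v n := by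
  refine le_trans ?_ (primeCountIn_le_of_dvd u v hd hn)
  rw [primeCountIn_prime u v hp, if_pos (Finset.mem_Ioc.2 ⟨hu, hv⟩)]

/-- If `F` is nonnegative and `F (d * m) ≤ F m`, its sum is controlled by its logarithmic mean. -/
theorem exists_sum_mul_log_le : ∃ C : ℝ, 0 < C ∧ ∀ (F : ℕ → ℝ), (∀ n, 0 ≤ F n) →
    (∀ d m, 1 ≤ d → 1 ≤ m → F (d * m) ≤ F m) → ∀ N : ℕ, 1 ≤ N →
    (∑ n ∈ Finset.Icc 1 N, F n) * Real.log N ≤ C * N * ∑ n ∈ Finset.Icc 1 N, F n / n := by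
  have hl4 : 0 < Real.log 4 := Real.log_pos (by norm_num)
  refine ⟨Real.log 4 + 5, by positivity, fun F hF0 hF N hN => ?_⟩
  have hlog : ∀ n ∈ Finset.Icc 1 N, F n * Real.log N ≤
      F n * Real.log n + N * (F n / n) := by
    intro n hn
    obtain ⟨hn1, hn2⟩ := Finset.mem_Icc.1 hn
    have h0 : (0 : ℝ) < n := by exact_mod_cast hn1
    have h1 : (0 : ℝ) < N := by exact_mod_cast hN
    have h2 : Real.log N - Real.log n ≤ N / n := by
      rw [← Real.log_div h1.ne' h0.ne']
      exact (Real.log_le_sub_one_of_pos (by positivity)).trans (by linarith)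
    calc F n * Real.log N = F n * Real.log n + F n * (Real.log N - Real.log n) := by ring
      _ ≤ F n * Real.log n + F n * (N / n) := by gcongr; exact hF0 n
      _ = _ := by ring
  have hmain : ∑ n ∈ Finset.Icc 1 N, F n * Real.log n ≤
      ∑ n ∈ Finset.Icc 1 N, F n * ((Real.log 4 + 4) * (N / n)) := by
    -- Write log n as the sum of Λ(d) over d ∣ n, use F(n) ≤ F(n/d), exchange the sums, and apply
    -- Chebyshev's bound for ψ(N/m).
    calc ∑ n ∈ Finset.Icc 1 N, F n * Real.log n
        = ∑ n ∈ Finset.Icc 1 N, ∑ x ∈ n.divisorsAntidiagonal,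
            ArithmeticFunction.vonMangoldt x.1 * F n := by
          refine Finset.sum_congr rfl fun n _ => ?_
          rw [← ArithmeticFunction.vonMangoldt_sum, Finset.mul_sum,
            ← Nat.map_div_right_divisors, Finset.sum_map]
          exact Finset.sum_congr rfl fun d _ => mul_comm _ _
      _ ≤ ∑ n ∈ Finset.Icc 1 N, ∑ x ∈ n.divisorsAntidiagonal,
            ArithmeticFunction.vonMangoldt x.1 * F x.2 := by
          refine Finset.sum_le_sum fun n _ => Finset.sum_le_sum fun x hx => ?_
          obtain ⟨hx1, hx2⟩ := Nat.mem_divisorsAntidiagonal.1 hx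
          refine mul_le_mul_of_nonneg_left ?_ ArithmeticFunction.vonMangoldt_nonneg
          rw [← hx1]
          rw [← hx1] at hx2
          exact hF _ _ (Nat.pos_of_ne_zero (left_ne_zero_of_mul hx2))
            (Nat.pos_of_ne_zero (right_ne_zero_of_mul hx2))
      _ = ∑ m ∈ Finset.Icc 1 N, ∑ d ∈ Finset.Icc 1 (N / m),
            ArithmeticFunction.vonMangoldt d * F m := by
          rw [Finset.sum_sigma', Finset.sum_sigma']
          refine Finset.sum_nbij' (fun x => ⟨x.2.2, x.2.1⟩) (fun y => ⟨y.2 * y.1, (y.2, y.1)⟩)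
            ?_ ?_ ?_ ?_ ?_
          · rintro ⟨n, d, m⟩ h
            simp only [Finset.mem_sigma, Finset.mem_Icc, Nat.mem_divisorsAntidiagonal] at h ⊢
            obtain ⟨⟨h1, h2⟩, rfl, h3⟩ := h
            have hd := Nat.pos_of_ne_zero (left_ne_zero_of_mul h3)
            have hm := Nat.pos_of_ne_zero (right_ne_zero_of_mul h3)
            refine ⟨⟨hm, by nlinarith⟩, hd, (Nat.le_div_iff_mul_le hm).2 h2⟩
          · rintro ⟨m, d⟩ h
            simp only [Finset.mem_sigma, Finset.mem_Icc, Nat.mem_divisorsAntidiagonal] at h ⊢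
            obtain ⟨⟨h1, h2⟩, h3, h4⟩ := h
            refine ⟨⟨Nat.mul_pos h3 h1, (Nat.le_div_iff_mul_le h1).1 h4⟩, trivial, ?_⟩
            positivity
          · rintro ⟨n, d, m⟩ h
            simp only [Finset.mem_sigma, Nat.mem_divisorsAntidiagonal] at h
            obtain ⟨-, rfl, -⟩ := h
            rfl
          · rintro ⟨m, d⟩ h
            rfl
          · rintro ⟨n, d, m⟩ h
            rfl
      _ ≤ ∑ n ∈ Finset.Icc 1 N, F n * ((Real.log 4 + 4) * (N / n)) := by
          refine Finset.sum_le_sum fun m hm => ?_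
          rw [← Finset.sum_mul, mul_comm]
          refine mul_le_mul_of_nonneg_left ?_ (hF0 m)
          have h1 := Chebyshev.psi_le_const_mul_self (x := (N / m : ℝ)) (by positivity)
          refine le_trans ?_ h1
          rw [Chebyshev.psi_eq_sum_Icc, Nat.floor_div_eq_div]
          refine Finset.sum_le_sum_of_subset_of_nonneg ?_
            fun _ _ _ => ArithmeticFunction.vonMangoldt_nonneg
          exact Finset.Icc_subset_Icc_left (Nat.zero_le 1)
  calc (∑ n ∈ Finset.Icc 1 N, F n) * Real.log N
      ≤ ∑ n ∈ Finset.Icc 1 N, (F n * Real.log n + N * (F n / n)) := by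
        rw [Finset.sum_mul]; exact Finset.sum_le_sum hlog
    _ ≤ ∑ n ∈ Finset.Icc 1 N, F n * ((Real.log 4 + 4) * (N / n)) +
        ∑ n ∈ Finset.Icc 1 N, N * (F n / n) := by
        rw [Finset.sum_add_distrib]; gcongr
    _ = _ := by
        rw [← Finset.sum_add_distrib, Finset.mul_sum]
        refine Finset.sum_congr rfl fun n _ => ?_
        ring

theorem sum_one_div_sq_prime_le (N : ℕ) :
    ∑ p ∈ N.primesBelow, 1 / (p : ℝ) ^ 2 ≤ ∑' n : ℕ, 1 / (n : ℝ) ^ 2 :=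
  (Real.summable_one_div_nat_pow.2 (by norm_num)).sum_le_tsum _ fun _ _ => by positivity

theorem inv_one_sub_le_exp {t q : ℝ} (h0 : 0 ≤ t) (htq : t ≤ q) (h1 : q ≤ 1 / 2) :
    (1 - t)⁻¹ ≤ Real.exp (t + 2 * q ^ 2) := by
  have h2 : 0 < 1 - t := by linarith
  have h3 : (1 - t)⁻¹ ≤ t + 2 * q ^ 2 + 1 := by
    rw [inv_le_iff_one_le_mul₀ h2]
    nlinarith [mul_nonneg h0 h0, sq_nonneg q]
  exact h3.trans (Real.add_one_le_exp _)

/-- Euler product bound for the logarithmic mean of a completely multiplicative function with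
values in `[0, 1]`. -/
theorem sum_div_le_exp {F : ℕ →* ℝ} (hF0 : ∀ n, 0 ≤ F n) (hF1 : ∀ n, F n ≤ 1) (N : ℕ) :
    ∑ n ∈ Finset.Icc 1 N, F n / n ≤
      Real.exp (∑ p ∈ (N + 1).primesBelow, F p / p + 2 * ∑' n : ℕ, 1 / (n : ℝ) ^ 2) := by
  let f : ℕ →* ℝ :=
    { toFun := fun n => F n / n
      map_one' := by simp
      map_mul' := fun m n => by rw [map_mul]; push_cast; ring }
  have hf0 : ∀ n, 0 ≤ f n := fun n => div_nonneg (hF0 n) (Nat.cast_nonneg n)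
  have hfp : ∀ n : ℕ, f n ≤ 1 / n := fun n =>
    div_le_div_of_nonneg_right (hF1 n) (Nat.cast_nonneg n)
  have hhalf : ∀ {p : ℕ}, p.Prime → 1 / (p : ℝ) ≤ 1 / 2 := fun {p} hp => by
    have : (2 : ℝ) ≤ p := by exact_mod_cast hp.two_le
    exact one_div_le_one_div_of_le (by norm_num) this
  have hlt : ∀ {p : ℕ}, p.Prime → ‖f p‖ < 1 := fun {p} hp => by
    rw [Real.norm_of_nonneg (hf0 p)]
    have := hfp p
    have := hhalf hp
    linarith
  obtain ⟨h1, h2⟩ :=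
    EulerProduct.summable_and_hasSum_smoothNumbers_prod_primesBelow_geometric (f := f) hlt (N + 1)
  have h3 : ∑ n ∈ Finset.Icc 1 N, F n / n ≤ ∏ p ∈ (N + 1).primesBelow, (1 - f p)⁻¹ := by
    -- Every n ≤ N is (N+1)-smooth, so the finite sum is part of the expanded Euler product.
    have hmem : ∀ n ∈ Finset.Icc 1 N, n ∈ (N + 1).smoothNumbers := fun n hn => by
      obtain ⟨hn1, hn2⟩ := Finset.mem_Icc.1 hn
      exact Nat.mem_smoothNumbers_of_lt hn1 (by omega)
    rw [← h2.tsum_eq, ← Finset.sum_attach]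
    have h4 := h2.summable.sum_le_tsum
      ((Finset.Icc 1 N).attach.map ⟨fun n => (⟨n.1, hmem n.1 n.2⟩ : (N + 1).smoothNumbers),
        fun a b hab => Subtype.ext (congrArg (fun t : (N + 1).smoothNumbers => (t : ℕ)) hab)⟩) (fun _ _ => hf0 _)
    rw [Finset.sum_map] at h4
    exact h4
  refine h3.trans ?_
  calc ∏ p ∈ (N + 1).primesBelow, (1 - f p)⁻¹
      ≤ ∏ p ∈ (N + 1).primesBelow, Real.exp (f p + 2 * (1 / (p : ℝ)) ^ 2) := by
        refine Finset.prod_le_prod (fun p hp => ?_) (fun p hp => ?_)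
        · have := hlt (Nat.prime_of_mem_primesBelow hp)
          rw [Real.norm_of_nonneg (hf0 p)] at this
          exact inv_nonneg.2 (by linarith)
        · exact inv_one_sub_le_exp (hf0 p) (hfp p) (hhalf (Nat.prime_of_mem_primesBelow hp))
    _ = Real.exp (∑ p ∈ (N + 1).primesBelow, F p / p +
          2 * ∑ p ∈ (N + 1).primesBelow, 1 / (p : ℝ) ^ 2) := by
        rw [← Real.exp_sum, Finset.sum_add_distrib, Finset.mul_sum]
        congr 2
        refine Finset.sum_congr rfl fun p _ => ?_
        rw [one_div_pow]
    _ ≤ _ := by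
        gcongr
        exact sum_one_div_sq_prime_le _

/-- The function `z ^ primeCountIn 0 y n` made multiplicative also at `0`. -/
noncomputable def powCount (z : ℝ) (y : ℕ) : ℕ →* ℝ where
  toFun n := if n = 0 then 0 else z ^ primeCountIn 0 y n
  map_one' := by simp [primeCountIn_one]
  map_mul' m n := by
    rcases eq_or_ne m 0 with rfl | hm
    · simp
    rcases eq_or_ne n 0 with rfl | hn
    · simp
    · simp [hm, hn, primeCountIn_mul 0 y hm hn, pow_add]

theorem powCount_of_pos {z : ℝ} {y n : ℕ} (hn : 1 ≤ n) :
    powCount z y n = z ^ primeCountIn 0 y n := by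
  simp [powCount, Nat.one_le_iff_ne_zero.1 hn]

theorem primeRecip_add {u v w : ℕ} (huv : u ≤ v) (hvw : v ≤ w) :
    primeRecip u v + primeRecip v w = primeRecip u w := by
  rw [primeRecip, primeRecip, primeRecip, ← Finset.Ioc_union_Ioc_eq_Ioc huv hvw,
    Finset.filter_union, Finset.sum_union]
  exact Finset.disjoint_filter_filter (Finset.Ioc_disjoint_Ioc_of_le le_rfl)

theorem exists_primeRecip_zero_le : ∃ C : ℝ, 0 < C ∧ ∀ v : ℕ, 2 ≤ v →
    primeRecip 0 v ≤ Real.log (Real.log v) + C := by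
  obtain ⟨C, hC, h⟩ := exists_abs_primeRecip_sub_le
  refine ⟨C + 2, by positivity, fun v hv => ?_⟩
  have h1 := (abs_le.1 (h 2 v le_rfl hv)).2
  have h2 : primeRecip 0 2 = 1 / 2 := by
    have : (Finset.Ioc 0 2).filter Nat.Prime = {2} := by decide
    rw [primeRecip, this]; simp
  have h3 : -1 ≤ Real.log (Real.log (2 : ℕ)) := by
    have := Real.log_two_gt_d9
    rw [Real.le_log_iff_exp_le (by push_cast; linarith), Real.exp_neg]
    have := Real.exp_one_gt_d9
    push_cast
    calc (Real.exp 1)⁻¹ ≤ 2⁻¹ := inv_anti₀ (by norm_num) (by linarith)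
      _ ≤ _ := by linarith
  rw [← primeRecip_add (Nat.zero_le 2) hv, h2]
  linarith

/-- The Hall-Tenenbaum upper bound for `z ^ primeCountIn 0 y n`. -/
theorem exists_sum_pow_primeCountIn_le : ∃ C : ℝ, 0 < C ∧ ∀ z : ℝ, 0 ≤ z → z ≤ 1 →
    ∀ y N : ℕ, 2 ≤ y → y ≤ N →
    ∑ n ∈ Finset.Icc 1 N, z ^ primeCountIn 0 y n ≤
      C * N * Real.exp ((z - 1) * Real.log (Real.log y)) := by
  obtain ⟨C₁, hC₁, h₁⟩ := exists_sum_mul_log_le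
  obtain ⟨C₂, hC₂, h₂⟩ := exists_primeRecip_zero_le
  obtain ⟨C₃, hC₃, h₃⟩ := exists_abs_primeRecip_sub_le
  set S := ∑' n : ℕ, 1 / (n : ℝ) ^ 2
  refine ⟨C₁ * Real.exp (C₂ + C₃ + 2 * S), by positivity, fun z hz0 hz1 y N hy hyN => ?_⟩
  have hF0 : ∀ n, 0 ≤ powCount z y n := fun n => by
    simp only [powCount, MonoidHom.coe_mk, OneHom.coe_mk]; split_ifs <;> positivity
  have hF1 : ∀ n, powCount z y n ≤ 1 := fun n => by
    simp only [powCount, MonoidHom.coe_mk, OneHom.coe_mk]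
    split_ifs
    · norm_num
    · exact pow_le_one₀ hz0 hz1
  have hlogN : 0 < Real.log N := Real.log_pos (by exact_mod_cast (by omega : 1 < N))
  have hA := h₁ (powCount z y) hF0 (fun d m _ _ => by
    rw [map_mul]; exact mul_le_of_le_one_left (hF0 m) (hF1 d)) N (by omega)
  have hB := sum_div_le_exp hF0 hF1 N
  have hP : ∑ p ∈ (N + 1).primesBelow, powCount z y p / p =
      z * primeRecip 0 y + primeRecip y N := by
    have : (N + 1).primesBelow = (Finset.Ioc 0 N).filter Nat.Prime := by
      ext p
      simp only [Nat.mem_primesBelow, Finset.mem_filter, Finset.mem_Ioc]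
      exact ⟨fun h => ⟨⟨h.2.pos, by omega⟩, h.2⟩, fun h => ⟨by omega, h.2⟩⟩
    rw [this, ← Finset.Ioc_union_Ioc_eq_Ioc (Nat.zero_le y) hyN, Finset.filter_union,
      Finset.sum_union (Finset.disjoint_filter_filter (Finset.Ioc_disjoint_Ioc_of_le le_rfl)),
      primeRecip, primeRecip, Finset.mul_sum]
    congr 1
    · refine Finset.sum_congr rfl fun p hp => ?_
      obtain ⟨hp1, hp2⟩ := Finset.mem_filter.1 hp
      rw [powCount_of_pos hp2.one_le, primeCountIn_prime 0 y hp2, if_pos hp1, pow_one]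
      ring
    · refine Finset.sum_congr rfl fun p hp => ?_
      obtain ⟨hp1, hp2⟩ := Finset.mem_filter.1 hp
      rw [powCount_of_pos hp2.one_le, primeCountIn_prime 0 y hp2, if_neg, pow_zero]
      simp only [Finset.mem_Ioc] at hp1 ⊢
      omega
  -- After exponentiation the term log log N becomes a factor log N, which cancels the one in
  -- `exists_sum_mul_log_le`.
  have hE : z * primeRecip 0 y + primeRecip y N ≤
      (z - 1) * Real.log (Real.log y) + Real.log (Real.log N) + (C₂ + C₃) := by
    have e1 := h₂ y hy
    have e2 := (abs_le.1 (h₃ y N hy hyN)).2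
    have e3 : z * primeRecip 0 y ≤ z * Real.log (Real.log y) + C₂ := by
      calc z * primeRecip 0 y ≤ z * (Real.log (Real.log y) + C₂) := by gcongr
        _ ≤ _ := by nlinarith
    linarith
  have hsum : ∑ n ∈ Finset.Icc 1 N, z ^ primeCountIn 0 y n =
      ∑ n ∈ Finset.Icc 1 N, powCount z y n :=
    Finset.sum_congr rfl fun n hn => (powCount_of_pos (Finset.mem_Icc.1 hn).1).symm
  rw [hsum]
  rw [hP] at hB
  have hB2 : ∑ n ∈ Finset.Icc 1 N, powCount z y n / n ≤
      Real.exp ((z - 1) * Real.log (Real.log y)) * Real.exp (C₂ + C₃ + 2 * S) * Real.log N := by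
    refine hB.trans ?_
    conv_rhs => rw [← Real.exp_log hlogN]
    rw [← Real.exp_add, ← Real.exp_add, Real.exp_le_exp]
    linarith
  have hfin : (∑ n ∈ Finset.Icc 1 N, powCount z y n) * Real.log N ≤
      (C₁ * Real.exp (C₂ + C₃ + 2 * S) * N * Real.exp ((z - 1) * Real.log (Real.log y))) *
        Real.log N := by
    refine hA.trans ?_
    calc C₁ * N * ∑ n ∈ Finset.Icc 1 N, powCount z y n / n ≤ C₁ * N *
        (Real.exp ((z - 1) * Real.log (Real.log y)) * Real.exp (C₂ + C₃ + 2 * S) * Real.log N) := by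
          gcongr
      _ = _ := by ring
  exact le_of_mul_le_mul_right hfin hlogN

/-- Rankin's bound for the integers having few prime factors up to `y`. -/
theorem exists_card_primeCountIn_le : ∃ C : ℝ, 0 < C ∧ ∀ z : ℝ, 0 ≤ z → z ≤ 1 →
    ∀ y N b : ℕ, 2 ≤ y → y ≤ N →
    (((Finset.Icc 1 N).filter fun n => primeCountIn 0 y n ≤ b).card : ℝ) * z ^ b ≤
      C * N * Real.exp ((z - 1) * Real.log (Real.log y)) := by
  obtain ⟨C, hC, h⟩ := exists_sum_pow_primeCountIn_le
  refine ⟨C, hC, fun z hz0 hz1 y N b hy hyN => le_trans ?_ (h z hz0 hz1 y N hy hyN)⟩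
  calc (((Finset.Icc 1 N).filter fun n => primeCountIn 0 y n ≤ b).card : ℝ) * z ^ b
      = ∑ n ∈ (Finset.Icc 1 N).filter fun n => primeCountIn 0 y n ≤ b, z ^ b := by simp
    _ ≤ ∑ n ∈ (Finset.Icc 1 N).filter fun n => primeCountIn 0 y n ≤ b,
          z ^ primeCountIn 0 y n :=
        Finset.sum_le_sum fun n hn => pow_le_pow_of_le_one hz0 hz1 (Finset.mem_filter.1 hn).2
    _ ≤ _ := Finset.sum_le_sum_of_subset_of_nonneg (Finset.filter_subset _ _)
        fun _ _ _ => pow_nonneg hz0 _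


/-! ### Lower bounds for numbers with prescribed numbers of prime factors -/

/-- The positive integers up to `Y` without prime factors up to `w`. -/
def roughUpTo (w Y : ℕ) : Finset ℕ := (Finset.Icc 1 Y).filter fun q => primeCountIn 0 w q = 0

/-- One sieve step: an integer lost when passing from w to w+1 is (w+1) times an integer still rough
up to w, so at most a proportion 1/(w+1) of the weight disappears. -/
theorem sum_roughUpTo_succ (w Y : ℕ) :
    (1 - 1 / ((w + 1 : ℕ) : ℝ)) * ∑ q ∈ roughUpTo w Y, 1 / (q : ℝ) ≤
      ∑ q ∈ roughUpTo (w + 1) Y, 1 / (q : ℝ) := by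
  have hsub : roughUpTo (w + 1) Y ⊆ roughUpTo w Y := by
    intro q hq
    simp only [roughUpTo, Finset.mem_filter] at hq ⊢
    refine ⟨hq.1, ?_⟩
    have := primeCountIn_add (Nat.zero_le w) (show w ≤ w + 1 by omega) q
    rw [hq.2] at this
    omega
  have hdiff : roughUpTo w Y \ roughUpTo (w + 1) Y ⊆ (roughUpTo w Y).image ((w + 1) * ·) := by
    intro q hq
    simp only [roughUpTo, Finset.mem_sdiff, Finset.mem_filter, Finset.mem_image,
      Finset.mem_Icc] at hq ⊢
    obtain ⟨⟨⟨hq1, hqY⟩, hq0⟩, hq2⟩ := hq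
    have h1 := primeCountIn_add (Nat.zero_le w) (show w ≤ w + 1 by omega) q
    have h2 : primeCountIn w (w + 1) q = q.factorization (w + 1) := by
      simp [primeCountIn]
    have h3 : q.factorization (w + 1) ≠ 0 := by
      rw [← h2]; intro h; apply hq2 ⟨⟨hq1, hqY⟩, ?_⟩; rw [← h1]; omega
    obtain ⟨r, rfl⟩ := Nat.dvd_of_factorization_pos h3
    have hr : r ≠ 0 := by rintro rfl; simp at hq1
    refine ⟨r, ⟨⟨Nat.pos_of_ne_zero hr, by nlinarith⟩, ?_⟩, rfl⟩
    have := primeCountIn_le_of_dvd 0 w (Dvd.intro_left (w + 1) rfl : r ∣ (w + 1) * r)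
      (by positivity)
    omega
  have h1 := Finset.sum_sdiff (f := fun q : ℕ => 1 / (q : ℝ)) hsub
  have h2 : ∑ q ∈ roughUpTo w Y \ roughUpTo (w + 1) Y, 1 / (q : ℝ) ≤
      1 / ((w + 1 : ℕ) : ℝ) * ∑ q ∈ roughUpTo w Y, 1 / (q : ℝ) := by
    refine (Finset.sum_le_sum_of_subset_of_nonneg hdiff fun _ _ _ => by positivity).trans ?_
    rw [Finset.sum_image fun a _ b _ h => Nat.eq_of_mul_eq_mul_left (Nat.succ_pos w) h,
      Finset.mul_sum]
    refine Finset.sum_le_sum fun q _ => le_of_eq ?_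
    push_cast
    field_simp
  linarith

theorem prod_mul_log_le_sum_roughUpTo (w Y : ℕ) :
    (∏ p ∈ (Finset.Ioc 0 w).filter Nat.Prime, (1 - 1 / (p : ℝ))) * Real.log Y ≤
      ∑ q ∈ roughUpTo w Y, 1 / (q : ℝ) := by
  induction w with
  | zero =>
    have h1 : roughUpTo 0 Y = Finset.Icc 1 Y := by simp [roughUpTo, primeCountIn]
    have h2 : ((harmonic Y : ℚ) : ℝ) = ∑ n ∈ Finset.Icc 1 Y, 1 / (n : ℝ) := by
      rw [harmonic_eq_sum_Icc]; push_cast; simp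
    have h3 := log_add_one_le_harmonic Y
    rw [h1, ← h2]
    simp only [Finset.Ioc_self, Finset.filter_empty, Finset.prod_empty, one_mul]
    refine le_trans ?_ h3
    rcases Nat.eq_zero_or_pos Y with rfl | hY
    · simp
    · apply Real.log_le_log (by exact_mod_cast hY); push_cast; linarith
  | succ w ih =>
    by_cases hw : (w + 1).Prime
    · have h1 : (Finset.Ioc 0 (w + 1)).filter Nat.Prime =
          insert (w + 1) ((Finset.Ioc 0 w).filter Nat.Prime) := by
        rw [← Finset.insert_Ioc_right_eq_Ioc_add_one (Nat.zero_le w), Finset.filter_insert,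
          if_pos hw]
      rw [h1, Finset.prod_insert (by simp), mul_assoc]
      refine le_trans ?_ (sum_roughUpTo_succ w Y)
      refine mul_le_mul_of_nonneg_left ih ?_
      rw [sub_nonneg, div_le_one (by positivity)]
      exact_mod_cast hw.one_le
    · have h1 : (Finset.Ioc 0 (w + 1)).filter Nat.Prime = (Finset.Ioc 0 w).filter Nat.Prime := by
        rw [← Finset.insert_Ioc_right_eq_Ioc_add_one (Nat.zero_le w), Finset.filter_insert,
          if_neg hw]
      have h2 : roughUpTo (w + 1) Y = roughUpTo w Y := by
        unfold roughUpTo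
        refine Finset.filter_congr fun q _ => ?_
        rw [← primeCountIn_add (Nat.zero_le w) (show w ≤ w + 1 by omega) q]
        have : primeCountIn w (w + 1) q = 0 := by
          simp [primeCountIn, Nat.factorization_eq_zero_of_not_prime q hw]
        omega
      rw [h1, h2]
      exact ih

theorem exists_le_sum_roughUpTo : ∃ c : ℝ, 0 < c ∧ ∀ w Y : ℕ, 2 ≤ w → 1 ≤ Y →
    c * Real.log Y * Real.exp (-Real.log (Real.log w)) ≤ ∑ q ∈ roughUpTo w Y, 1 / (q : ℝ) := by
  obtain ⟨C, hC, h⟩ := exists_primeRecip_zero_le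
  set S := ∑' n : ℕ, 1 / (n : ℝ) ^ 2
  refine ⟨Real.exp (-(C + 2 * S)), by positivity, fun w Y hw hY => ?_⟩
  refine le_trans ?_ (prod_mul_log_le_sum_roughUpTo w Y)
  have hlog : 0 ≤ Real.log Y := Real.log_natCast_nonneg Y
  have h1 : Real.exp (-(primeRecip 0 w + 2 * S)) ≤
      ∏ p ∈ (Finset.Ioc 0 w).filter Nat.Prime, (1 - 1 / (p : ℝ)) := by
    calc Real.exp (-(primeRecip 0 w + 2 * S))
        ≤ Real.exp (∑ p ∈ (Finset.Ioc 0 w).filter Nat.Prime,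
            (-(1 / (p : ℝ) + 2 * (1 / (p : ℝ)) ^ 2))) := by
          rw [Finset.sum_neg_distrib, Finset.sum_add_distrib, ← Finset.mul_sum]
          have : ∑ p ∈ (Finset.Ioc 0 w).filter Nat.Prime, (1 / (p : ℝ)) ^ 2 ≤ S := by
            simp_rw [one_div_pow]
            exact (Real.summable_one_div_nat_pow.2 (by norm_num)).sum_le_tsum _
              fun _ _ => by positivity
          rw [Real.exp_le_exp, primeRecip]
          linarith
      _ = ∏ p ∈ (Finset.Ioc 0 w).filter Nat.Prime,
            Real.exp (-(1 / (p : ℝ) + 2 * (1 / (p : ℝ)) ^ 2)) := Real.exp_sum _ _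
      _ ≤ _ := by
          refine Finset.prod_le_prod (fun _ _ => (Real.exp_pos _).le) fun p hp => ?_
          have hp2 : (2 : ℝ) ≤ p := by exact_mod_cast (Finset.mem_filter.1 hp).2.two_le
          have hp3 : 1 / (p : ℝ) ≤ 1 / 2 := one_div_le_one_div_of_le (by norm_num) hp2
          have h2 := inv_one_sub_le_exp (t := 1 / (p : ℝ)) (by positivity) le_rfl hp3
          rw [Real.exp_neg]
          exact (inv_le_comm₀ (by linarith) (Real.exp_pos _)).1 h2
  calc Real.exp (-(C + 2 * S)) * Real.log Y * Real.exp (-Real.log (Real.log w))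
      = Real.exp (-(C + 2 * S) + -Real.log (Real.log w)) * Real.log Y := by
        rw [Real.exp_add]; ring
    _ ≤ Real.exp (-(primeRecip 0 w + 2 * S)) * Real.log Y := by
        gcongr
        linarith [h w hw]
    _ ≤ _ := by gcongr

/-- All products of a prime in `(u, v]` with an element of `E`. -/
def primeMul (u v : ℕ) (E : Finset ℕ) : Finset ℕ :=
  (((Finset.Ioc u v).filter Nat.Prime) ×ˢ E).image fun x => x.1 * x.2

theorem card_primes_dvd_le (u v : ℕ) {n : ℕ} (hn : n ≠ 0) :
    (((Finset.Ioc u v).filter Nat.Prime).filter (· ∣ n)).card ≤ primeCountIn u v n := by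
  rw [Finset.card_eq_sum_ones, primeCountIn]
  refine (Finset.sum_le_sum fun p hp => ?_).trans
    (Finset.sum_le_sum_of_subset ((Finset.filter_subset _ _).trans (Finset.filter_subset _ _)))
  simp only [Finset.mem_filter] at hp
  exact hp.1.2.factorization_pos_of_dvd hn hp.2

/-- A product n = pe has at most j+1 representations, because p is one of its at most j+1 prime
divisors in the window. Iteration produces the factor 1/j!. -/
theorem primeRecip_mul_sum_le {u v j : ℕ} {E : Finset ℕ}
    (hE : ∀ e ∈ E, e ≠ 0 ∧ primeCountIn u v e = j) :
    primeRecip u v * ∑ e ∈ E, 1 / (e : ℝ) ≤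
      (j + 1 : ℕ) * ∑ e ∈ primeMul u v E, 1 / (e : ℝ) := by
  have h1 : primeRecip u v * ∑ e ∈ E, 1 / (e : ℝ) =
      ∑ x ∈ ((Finset.Ioc u v).filter Nat.Prime) ×ˢ E, 1 / ((x.1 * x.2 : ℕ) : ℝ) := by
    rw [primeRecip, Finset.sum_mul_sum, Finset.sum_product]
    refine Finset.sum_congr rfl fun p _ => Finset.sum_congr rfl fun e _ => ?_
    push_cast
    rw [one_div_mul_one_div]
  rw [h1, ← Finset.sum_fiberwise_of_maps_to
    (g := fun x : ℕ × ℕ => x.1 * x.2) (t := primeMul u v E)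
    (fun x hx => Finset.mem_image_of_mem _ hx), Finset.mul_sum]
  refine Finset.sum_le_sum fun n hn => ?_
  obtain ⟨⟨p, e⟩, hx, rfl⟩ := Finset.mem_image.1 hn
  obtain ⟨hp, he⟩ := Finset.mem_product.1 hx
  obtain ⟨hpI, hpp⟩ := Finset.mem_filter.1 hp
  obtain ⟨he0, hej⟩ := hE e he
  simp only at hp he hpI hpp he0 hej ⊢
  set n := p * e with hndef
  have hn0 : n ≠ 0 := mul_ne_zero hpp.ne_zero he0
  have hcount : primeCountIn u v n = j + 1 := by
    rw [hndef, primeCountIn_mul u v hpp.ne_zero he0, hej, primeCountIn_prime u v hpp, if_pos hpI,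
      add_comm]
  rw [Finset.sum_congr rfl (g := fun _ => 1 / (n : ℝ)) fun x hx => by
    rw [(Finset.mem_filter.1 hx).2], Finset.sum_const, nsmul_eq_mul]
  refine mul_le_mul_of_nonneg_right ?_ (by positivity)
  rw [← hcount]
  refine Nat.cast_le.2 ((Finset.card_le_card_of_injOn Prod.fst ?_ ?_).trans
    (card_primes_dvd_le u v hn0))
  · rintro ⟨p', e'⟩ hx
    simp only [Finset.coe_filter, Finset.mem_product, mem_ofPred_eq, Finset.mem_filter] at hx ⊢
    exact ⟨hx.1.1, hx.2 ▸ Dvd.intro _ rfl⟩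
  · rintro ⟨p₁, e₁⟩ h₁ ⟨p₂, e₂⟩ h₂ h
    simp only [Finset.coe_filter, Finset.mem_product, mem_ofPred_eq, Finset.mem_filter] at h₁ h₂ h
    subst h
    have := Nat.eq_of_mul_eq_mul_left h₁.1.1.2.pos (h₁.2.trans h₂.2.symm)
    rw [this]

/-- The cofactor d is built from window primes only. Recording this, with its size, lets
`exists_prescribed` treat the windows one after another without disturbing earlier counts. -/
theorem exists_primeMul_iterate {u v : ℕ} {E : Finset ℕ}
    (hE : ∀ e ∈ E, e ≠ 0 ∧ primeCountIn u v e = 0) (j : ℕ) :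
    ∃ E' : Finset ℕ, (∀ n ∈ E', n ≠ 0 ∧ primeCountIn u v n = j ∧ ∃ e ∈ E, ∃ d, n = d * e ∧
      d ≠ 0 ∧ d ≤ v ^ j ∧ ∀ u' v', v' ≤ u ∨ v ≤ u' → primeCountIn u' v' d = 0) ∧
      primeRecip u v ^ j / j.factorial * ∑ e ∈ E, 1 / (e : ℝ) ≤ ∑ e ∈ E', 1 / (e : ℝ) := by
  induction j with
  | zero =>
    refine ⟨E, fun n hn => ⟨(hE n hn).1, (hE n hn).2, n, hn, 1, by simp, by simp, by simp, ?_⟩,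
      by simp⟩
    intro u' v' _
    exact primeCountIn_one u' v'
  | succ j ih =>
    obtain ⟨E', hE', hs⟩ := ih
    have hstep := primeRecip_mul_sum_le (u := u) (v := v) (j := j) (E := E')
      fun e he => ⟨(hE' e he).1, (hE' e he).2.1⟩
    refine ⟨primeMul u v E', fun n hn => ?_, ?_⟩
    · obtain ⟨⟨p, m⟩, hx, rfl⟩ := Finset.mem_image.1 hn
      obtain ⟨hp, hm⟩ := Finset.mem_product.1 hx
      obtain ⟨hpI, hpp⟩ := Finset.mem_filter.1 hp
      obtain ⟨hm0, hmj, e, he, d, rfl, hd0, hdv, hd⟩ := hE' m hm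
      simp only at hp hm hpI hpp hm0 hmj ⊢
      refine ⟨mul_ne_zero hpp.ne_zero hm0, ?_, e, he, p * d, (mul_assoc _ _ _).symm,
        mul_ne_zero hpp.ne_zero hd0, ?_, ?_⟩
      · rw [primeCountIn_mul u v hpp.ne_zero hm0, hmj, primeCountIn_prime u v hpp, if_pos hpI,
          add_comm]
      · rw [pow_succ']
        exact Nat.mul_le_mul (Finset.mem_Ioc.1 hpI).2 hdv
      · intro u' v' h
        rw [primeCountIn_mul u' v' hpp.ne_zero hd0, hd u' v' h, primeCountIn_prime u' v' hpp,
          if_neg]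
        simp only [Finset.mem_Ioc] at hpI ⊢
        omega
    · have hr : 0 ≤ primeRecip u v := Finset.sum_nonneg fun _ _ => by positivity
      have h1 := mul_le_mul_of_nonneg_left hs hr
      have h2 := h1.trans hstep
      have hj : (0 : ℝ) < (j + 1 : ℕ) := by positivity
      rw [Nat.factorial_succ, pow_succ', Nat.cast_mul]
      calc primeRecip u v * primeRecip u v ^ j / ((j + 1 : ℕ) * j.factorial) *
            ∑ e ∈ E, 1 / (e : ℝ)
          = (primeRecip u v * (primeRecip u v ^ j / j.factorial * ∑ e ∈ E, 1 / (e : ℝ))) /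
            (j + 1 : ℕ) := by
            field_simp
        _ ≤ _ := by rw [div_le_iff₀ hj]; linarith

/-- Integers with prescribed numbers `j i` of prime factors in the windows `(y (i+2), y (i+1)]`
and no smaller prime factors, built from integers without prime factors up to `y 1`. -/
theorem exists_prescribed {y : ℕ → ℕ} (hy : Antitone y) (j : ℕ → ℕ) (Y k : ℕ) :
    ∃ E : Finset ℕ, (∀ e ∈ E, e ≠ 0 ∧ e ≤ Y * y 1 ^ (∑ i ∈ Finset.range k, j i) ∧
      (∀ i < k, primeCountIn (y (i + 2)) (y (i + 1)) e = j i) ∧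
      primeCountIn 0 (y (k + 1)) e = 0) ∧
      (∏ i ∈ Finset.range k, primeRecip (y (i + 2)) (y (i + 1)) ^ j i / (j i).factorial) *
        ∑ q ∈ roughUpTo (y 1) Y, 1 / (q : ℝ) ≤ ∑ e ∈ E, 1 / (e : ℝ) := by
  induction k with
  | zero =>
    refine ⟨roughUpTo (y 1) Y, fun e he => ?_, by simp⟩
    simp only [roughUpTo, Finset.mem_filter, Finset.mem_Icc] at he
    exact ⟨by omega, by simpa using he.1.2, by simp, he.2⟩
  | succ k ih =>
    obtain ⟨E, hE, hs⟩ := ih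
    have hle : y (k + 2) ≤ y (k + 1) := hy (by omega)
    obtain ⟨E', hE', hs'⟩ := exists_primeMul_iterate (u := y (k + 2)) (v := y (k + 1)) (E := E)
      (fun e he => ⟨(hE e he).1, by
        have := primeCountIn_add (Nat.zero_le _) hle e
        have := (hE e he).2.2.2
        omega⟩) (j k)
    refine ⟨E', fun n hn => ?_, ?_⟩
    · obtain ⟨hn0, hnj, e, he, d, rfl, hd0, hdv, hd⟩ := hE' n hn
      obtain ⟨he0, heY, hei, hek⟩ := hE e he
      refine ⟨hn0, ?_, fun i hi => ?_, ?_⟩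
      · rw [Finset.sum_range_succ, pow_add, mul_comm d e, ← mul_assoc]
        exact Nat.mul_le_mul heY (hdv.trans (Nat.pow_le_pow_left (hy (by omega)) _))
      · rcases Nat.lt_succ_iff_lt_or_eq.1 hi with hi' | rfl
        · rw [primeCountIn_mul _ _ hd0 he0, hei i hi', hd _ _ (Or.inr (hy (by omega))), zero_add]
        · exact hnj
      · have := primeCountIn_add (Nat.zero_le _) hle e
        rw [primeCountIn_mul _ _ hd0 he0, hd _ _ (Or.inl le_rfl), zero_add]
        change primeCountIn 0 (y (k + 2)) e = 0
        omega
    · refine le_trans ?_ hs'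
      rw [Finset.prod_range_succ, mul_comm (∏ i ∈ Finset.range k, _), mul_assoc]
      refine mul_le_mul_of_nonneg_left hs ?_
      have hr : 0 ≤ primeRecip (y (k + 2)) (y (k + 1)) :=
        Finset.sum_nonneg fun _ _ => by positivity
      positivity

/-! ### From logarithmic weights to counting, by a large prime factor. -/

theorem exists_half_mul_le_theta : ∃ n₀ : ℕ, ∀ n : ℕ, n₀ ≤ n →
    (n : ℝ) / 2 ≤ Chebyshev.theta n := by
  have h1 : (fun x : ℝ => Real.log (x + 1)) =o[atTop] (fun x : ℝ => x) := by
    have h := Real.isLittleO_log_id_atTop.comp_tendsto (tendsto_atTop_add_const_right atTop (1 : ℝ) tendsto_id)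
    refine h.trans_isBigO ?_
    refine IsBigO.of_bound 2 ?_
    filter_upwards [eventually_ge_atTop 1] with x hx
    simp only [Function.comp, id, Real.norm_eq_abs]
    rw [abs_of_nonneg (by linarith), abs_of_nonneg (by linarith)]
    linarith
  have h2 : (fun x : ℝ => √x * Real.log x) =o[atTop] (fun x : ℝ => x) := by
    have h := isLittleO_log_rpow_atTop (r := 1 / 2) (by norm_num)
    have h' := (isBigO_refl (fun x : ℝ => √x) atTop).mul_isLittleO h
    refine h'.congr' (EventuallyEq.rfl) ?_
    filter_upwards [eventually_ge_atTop 0] with x hx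
    rw [← Real.sqrt_eq_rpow, Real.mul_self_sqrt hx]
  have e1 := tendsto_natCast_atTop_atTop.eventually (h1.bound (c := 1 / 20) (by norm_num))
  have e2 := tendsto_natCast_atTop_atTop.eventually (h2.bound (c := 1 / 20) (by norm_num))
  obtain ⟨n₀, hn₀⟩ := eventually_atTop.1 (e1.and e2)
  refine ⟨n₀, fun n hn => ?_⟩
  obtain ⟨b1, b2⟩ := hn₀ n hn
  have h := Chebyshev.theta_ge n
  have hl := Real.log_two_gt_d9
  have hn0 : (0 : ℝ) ≤ n := Nat.cast_nonneg n
  rw [Real.norm_eq_abs, Real.norm_eq_abs, abs_of_nonneg hn0] at b1 b2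
  have b1' := (abs_le.1 b1).2
  have b2' := (abs_le.1 b2).2
  nlinarith

theorem sum_log_prime_dvd_le {n : ℕ} (hn : n ≠ 0) (P : Finset ℕ)
    (hP : ∀ p ∈ P, p.Prime ∧ p ∣ n) : ∑ p ∈ P, Real.log p ≤ Real.log n := by
  rw [← Real.log_prod fun p hp => by exact_mod_cast (hP p hp).1.ne_zero, ← Nat.cast_prod]
  have h1 : ∏ p ∈ P, p ∣ n := Finset.prod_primes_dvd n (fun p hp => (hP p hp).1.prime)
    fun p hp => (hP p hp).2
  exact Real.log_le_log (by exact_mod_cast Nat.pos_of_dvd_of_pos h1 (Nat.pos_of_ne_zero hn))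
    (by exact_mod_cast Nat.le_of_dvd (Nat.pos_of_ne_zero hn) h1)

/-- The multiples `e * p ≤ X` with `e ∈ E` and `p > w` prime. -/
def largePrimeMul (w X : ℕ) (E : Finset ℕ) : Finset ℕ :=
  (E.sigma fun e => (Finset.Ioc w (X / e)).filter Nat.Prime).image fun x => x.1 * x.2

/-- Weight each pair (e, p) by log p. For fixed e the weights sum to θ(X/e) - θ(w) ≥ X/(8e), while
for fixed n = ep ≤ X the eligible p are distinct prime divisors of n, with total weight at most log
X. -/
theorem exists_le_card_largePrimeMul : ∃ n₀ : ℕ, ∀ (w X : ℕ) (E : Finset ℕ), 1 ≤ X →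
    (∀ e ∈ E, e ≠ 0 ∧ n₀ ≤ X / e ∧ 8 * w ≤ X / e ∧ 1 ≤ X / e) →
    (X : ℝ) / 8 * ∑ e ∈ E, 1 / (e : ℝ) ≤ (largePrimeMul w X E).card * Real.log X := by
  obtain ⟨n₀, hn₀⟩ := exists_half_mul_le_theta
  refine ⟨n₀, fun w X E hX hE => ?_⟩
  have h1 : (X : ℝ) / 8 * ∑ e ∈ E, 1 / (e : ℝ) ≤
      ∑ e ∈ E, ∑ p ∈ (Finset.Ioc w (X / e)).filter Nat.Prime, Real.log p := by
    rw [Finset.mul_sum]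
    refine Finset.sum_le_sum fun e he => ?_
    obtain ⟨he0, hen, hew, he1⟩ := hE e he
    have t1 := hn₀ _ hen
    have t2 := Chebyshev.theta_le_log4_mul_x (x := w) (Nat.cast_nonneg w)
    have t3 : ∑ p ∈ (Finset.Ioc w (X / e)).filter Nat.Prime, Real.log p =
        Chebyshev.theta (X / e : ℕ) - Chebyshev.theta w := by
      rw [Chebyshev.theta, Chebyshev.theta, Nat.floor_natCast, Nat.floor_natCast,
        ← Finset.Ioc_union_Ioc_eq_Ioc (Nat.zero_le w) (by omega : w ≤ X / e),
        Finset.filter_union, Finset.sum_union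
          (Finset.disjoint_filter_filter (Finset.Ioc_disjoint_Ioc_of_le le_rfl))]
      ring
    have hl : Real.log 4 ≤ 1.4 := by
      have : Real.log 4 = 2 * Real.log 2 := by
        rw [← Real.log_rpow (by norm_num)]; norm_num
      linarith [Real.log_two_lt_d9]
    have t4 : (8 : ℝ) * w ≤ (X / e : ℕ) := by exact_mod_cast hew
    have he0' : (0 : ℝ) < e := by exact_mod_cast Nat.pos_of_ne_zero he0
    have t5 : (X : ℝ) / e ≤ 2 * (X / e : ℕ) := by
      rw [div_le_iff₀ he0']
      have := Nat.lt_div_mul_add (a := X) (Nat.pos_of_ne_zero he0)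
      exact_mod_cast (by nlinarith : X ≤ 2 * (X / e) * e)
    rw [t3]
    have hw0 : (0 : ℝ) ≤ w := Nat.cast_nonneg w
    have : (X : ℝ) / 8 * (1 / e) = X / e / 8 := by ring
    rw [this]
    nlinarith
  refine h1.trans ?_
  rw [Finset.sum_sigma', ← Finset.sum_fiberwise_of_maps_to
    (g := fun x : (_ : ℕ) × ℕ => x.1 * x.2) (t := largePrimeMul w X E)
    (fun x hx => Finset.mem_image_of_mem _ hx), ← nsmul_eq_mul]
  refine Finset.sum_le_card_nsmul _ _ _ fun n hn => ?_
  obtain ⟨⟨e, p⟩, hx, rfl⟩ := Finset.mem_image.1 hn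
  simp only [Finset.mem_sigma, Finset.mem_filter, Finset.mem_Ioc] at hx
  obtain ⟨he, ⟨hpw, hpX⟩, hpp⟩ := hx
  obtain ⟨he0, -⟩ := hE e he
  simp only at hpw hpX hpp he0 ⊢
  set n := e * p with hndef
  have hn0 : n ≠ 0 := mul_ne_zero he0 hpp.ne_zero
  have hnX : n ≤ X := by
    rw [hndef, mul_comm]; exact (Nat.le_div_iff_mul_le (Nat.pos_of_ne_zero he0)).1 hpX
  -- For a fixed product n the prime p determines e, so the fibre is a set of prime divisors of n.
  have hinj : Set.InjOn (fun x : (_ : ℕ) × ℕ => x.2)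
      (((E.sigma fun e => (Finset.Ioc w (X / e)).filter Nat.Prime).filter
        fun x => x.1 * x.2 = n : Finset ((_ : ℕ) × ℕ)) : Set ((_ : ℕ) × ℕ)) := by
    rintro ⟨e₁, p₁⟩ h₁ ⟨e₂, p₂⟩ h₂ h
    simp only [Finset.coe_filter, Finset.mem_sigma, Finset.mem_filter, mem_ofPred_eq] at h₁ h₂ h
    subst h
    have := Nat.eq_of_mul_eq_mul_right h₁.1.2.2.pos (h₁.2.trans h₂.2.symm)
    rw [this]
  rw [← Finset.sum_image (f := fun p : ℕ => Real.log p) hinj]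
  refine (sum_log_prime_dvd_le hn0 _ ?_).trans
    (Real.log_le_log (by exact_mod_cast Nat.pos_of_ne_zero hn0) (by exact_mod_cast hnX))
  intro p' hp'
  obtain ⟨⟨e₁, p₁⟩, h₁, rfl⟩ := Finset.mem_image.1 hp'
  simp only [Finset.mem_sigma, Finset.mem_filter] at h₁
  exact ⟨h₁.1.2.2, h₁.2 ▸ Dvd.intro_left _ rfl⟩


/-! ### The scale `⌊exp (exp t)⌋` -/

/-- The integer part of `exp (exp t)`. -/
noncomputable def expExp (t : ℝ) : ℕ := ⌊Real.exp (Real.exp t)⌋₊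

theorem expExp_mono : Monotone expExp := fun _ _ h =>
  Nat.floor_mono (Real.exp_le_exp.2 (Real.exp_le_exp.2 h))

theorem expExp_le (t : ℝ) : (expExp t : ℝ) ≤ Real.exp (Real.exp t) :=
  Nat.floor_le (Real.exp_pos _).le

theorem lt_expExp_add_one (t : ℝ) : Real.exp (Real.exp t) < expExp t + 1 := Nat.lt_floor_add_one _

theorem two_le_expExp {t : ℝ} (ht : 0 ≤ t) : 2 ≤ expExp t := by
  apply Nat.le_floor
  have h1 := Real.add_one_le_exp t
  have h2 : Real.exp 1 ≤ Real.exp (Real.exp t) := Real.exp_le_exp.2 (by linarith)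
  have := Real.exp_one_gt_d9
  push_cast
  linarith

theorem half_exp_exp_le {t : ℝ} (ht : 0 ≤ t) : Real.exp (Real.exp t) / 2 ≤ expExp t := by
  have h1 : (2 : ℝ) ≤ expExp t := by exact_mod_cast two_le_expExp ht
  linarith [lt_expExp_add_one t]

theorem log_expExp_le {t : ℝ} (ht : 0 ≤ t) : Real.log (expExp t) ≤ Real.exp t := by
  have h1 : (2 : ℝ) ≤ expExp t := by exact_mod_cast two_le_expExp ht
  rw [Real.log_le_iff_le_exp (by linarith)]
  exact expExp_le t

/-- The integer part costs at most log 2 in the logarithm, which a shift of t by 1 absorbs. -/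
theorem exp_sub_one_le_log_expExp {t : ℝ} (ht : 1 ≤ t) :
    Real.exp (t - 1) ≤ Real.log (expExp t) := by
  have h0 : (0 : ℝ) < Real.exp (Real.exp t) / 2 := by positivity
  have h1 := Real.log_le_log h0 (half_exp_exp_le (by linarith : (0 : ℝ) ≤ t))
  rw [Real.log_div (by positivity) (by norm_num), Real.log_exp] at h1
  refine le_trans ?_ h1
  have h2 : Real.exp t = Real.exp (t - 1) * Real.exp 1 := by rw [← Real.exp_add]; ring_nf
  have h3 : 1 ≤ Real.exp (t - 1) := Real.one_le_exp (by linarith)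
  have h4 := Real.exp_one_gt_d9
  have h5 := Real.log_two_lt_d9
  rw [h2]
  nlinarith

theorem log_log_expExp_le {t : ℝ} (ht : 1 ≤ t) : Real.log (Real.log (expExp t)) ≤ t := by
  have h := exp_sub_one_le_log_expExp ht
  rw [Real.log_le_iff_le_exp ((Real.exp_pos _).trans_le h)]
  exact log_expExp_le (by linarith)

theorem le_log_log_expExp {t : ℝ} (ht : 1 ≤ t) : t - 1 ≤ Real.log (Real.log (expExp t)) := by
  have h := exp_sub_one_le_log_expExp ht
  rw [Real.le_log_iff_exp_le ((Real.exp_pos _).trans_le h)]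
  exact h

theorem expExp_sq_le {t : ℝ} (ht : 1 ≤ t) : expExp t ^ 2 ≤ expExp (2 * t) := by
  apply Nat.le_floor
  push_cast
  calc (expExp t : ℝ) ^ 2 ≤ Real.exp (Real.exp t) ^ 2 := by gcongr; exact expExp_le t
    _ = Real.exp (2 * Real.exp t) := by rw [← Real.exp_nat_mul]; norm_num
    _ ≤ Real.exp (Real.exp (2 * t)) := by
        rw [Real.exp_le_exp]
        have h1 := Real.add_one_le_exp t
        have h2 : Real.exp (2 * t) = Real.exp t * Real.exp t := by rw [← Real.exp_add]; ring_nf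
        rw [h2]
        nlinarith

theorem tendsto_expExp : Tendsto expExp atTop atTop :=
  tendsto_nat_floor_atTop.comp (Real.tendsto_exp_atTop.comp Real.tendsto_exp_atTop)

/-- Rankin's bound with z = B, for which B^(-Bt) e^((B-1)t) = e^(-φ(B)t). -/
theorem exists_card_primeCountIn_expExp_le : ∃ C : ℝ, 0 < C ∧ ∀ B : ℝ, 0 ≤ B → B ≤ 1 →
    ∀ (t : ℝ) (N : ℕ), 1 ≤ t → expExp t ≤ N →
    (((Finset.Icc 1 N).filter fun n => (primeCountIn 0 (expExp t) n : ℝ) ≤ B * t).card : ℝ) ≤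
      C * N * Real.exp (-(phi B * t)) := by
  obtain ⟨C, hC, h⟩ := exists_card_primeCountIn_le
  refine ⟨C * Real.exp 1, by positivity, fun B hB0 hB1 t N ht hN => ?_⟩
  have hBt : 0 ≤ B * t := by positivity
  have h1 := h B hB0 hB1 (expExp t) N ⌊B * t⌋₊ (two_le_expExp (by linarith)) hN
  have h2 : (Finset.Icc 1 N).filter (fun n => (primeCountIn 0 (expExp t) n : ℝ) ≤ B * t) =
      (Finset.Icc 1 N).filter fun n => primeCountIn 0 (expExp t) n ≤ ⌊B * t⌋₊ :=
    Finset.filter_congr fun n _ => (Nat.le_floor_iff hBt).symm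
  rw [h2]
  have h3 : Real.exp (t * (B * Real.log B)) ≤ B ^ ⌊B * t⌋₊ := by
    -- At B = 0 the conventions 0 · log 0 = 0 and 0^0 = 1 give the bound.
    rcases hB0.eq_or_lt with rfl | hB
    · simp
    · rw [← Real.exp_log (pow_pos hB _), Real.exp_le_exp, Real.log_pow]
      have := Nat.floor_le hBt
      have := Real.log_nonpos hB0 hB1
      nlinarith
  have h4 : Real.exp ((B - 1) * Real.log (Real.log (expExp t))) ≤
      Real.exp 1 * Real.exp ((B - 1) * t) := by
    rw [← Real.exp_add, Real.exp_le_exp]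
    have := le_log_log_expExp ht
    nlinarith
  set c : ℝ := (((Finset.Icc 1 N).filter fun n => primeCountIn 0 (expExp t) n ≤ ⌊B * t⌋₊).card : ℝ)
  have h5 : c * Real.exp (t * (B * Real.log B)) ≤
      C * N * (Real.exp 1 * Real.exp ((B - 1) * t)) :=
    calc c * Real.exp (t * (B * Real.log B)) ≤ c * B ^ ⌊B * t⌋₊ := by gcongr
      _ ≤ _ := h1
      _ ≤ _ := by gcongr
  have h6 : Real.exp (-(phi B * t)) * Real.exp (t * (B * Real.log B)) =
      Real.exp ((B - 1) * t) := by
    rw [← Real.exp_add, phi]; ring_nf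
  refine le_of_mul_le_mul_right ?_ (Real.exp_pos (t * (B * Real.log B)))
  calc c * Real.exp (t * (B * Real.log B)) ≤ C * N * (Real.exp 1 * Real.exp ((B - 1) * t)) := h5
    _ = _ := by rw [← h6]; ring

/-! ### The removed sets -/

/-- The integers in `(expExp (r ^ M * L), expExp L]` having, for `1 ≤ i ≤ M`, at most
`B * r ^ i * L` prime factors up to `expExp (r ^ i * L)`. -/
noncomputable def removed (B r : ℝ) (M : ℕ) (L : ℝ) : Finset ℕ := by
  classical
  exact (Finset.Ioc (expExp (r ^ M * L)) (expExp L)).filter fun m =>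
    ∀ i, 1 ≤ i → i ≤ M → (primeCountIn 0 (expExp (r ^ i * L)) m : ℝ) ≤ B * (r ^ i * L)

theorem mem_removed {B r : ℝ} {M : ℕ} {L : ℝ} {m : ℕ} : m ∈ removed B r M L ↔
    (expExp (r ^ M * L) < m ∧ m ≤ expExp L) ∧
    ∀ i, 1 ≤ i → i ≤ M → (primeCountIn 0 (expExp (r ^ i * L)) m : ℝ) ≤ B * (r ^ i * L) := by
  simp [removed]

/-- Monotonicity of x (log x)^(-a), which carries the sparsity bound from the end of a removed set
to all larger N. -/
theorem mul_log_rpow_le {a x₀ x : ℝ} (ha1 : a ≤ 1) (hx₀ : 1 ≤ Real.log x₀)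
    (hx₀' : 0 < x₀) (hx : x₀ ≤ x) :
    x₀ * Real.log x₀ ^ (-a) ≤ x * Real.log x ^ (-a) := by
  have hlog : Real.log x₀ ≤ Real.log x := Real.log_le_log hx₀' hx
  have h0 : 0 < Real.log x₀ := by linarith
  have h1 : 0 < Real.log x := by linarith
  have h2 : Real.log x / Real.log x₀ ≤ x / x₀ := by
    have h3 : Real.log x - Real.log x₀ ≤ x / x₀ - 1 := by
      rw [← Real.log_div (by linarith) hx₀'.ne']
      exact Real.log_le_sub_one_of_pos (by have : 0 < x := by linarith
                                           positivity)
    have h4 : 1 ≤ x / x₀ := (one_le_div hx₀').2 hx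
    rw [div_le_iff₀ h0]
    nlinarith
  have h5 : (Real.log x / Real.log x₀) ^ a ≤ x / x₀ := by
    calc (Real.log x / Real.log x₀) ^ a ≤ (Real.log x / Real.log x₀) ^ (1 : ℝ) :=
          Real.rpow_le_rpow_of_exponent_le ((one_le_div h0).2 hlog) ha1
      _ ≤ _ := by rw [Real.rpow_one]; exact h2
  rw [Real.div_rpow h1.le h0.le, div_le_div_iff₀ (by positivity) hx₀'] at h5
  rw [Real.rpow_neg h0.le, Real.rpow_neg h1.le, ← div_eq_mul_inv, ← div_eq_mul_inv,
    div_le_div_iff₀ (by positivity) (by positivity)]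
  linarith

theorem exists_scale (y : ℕ → ℕ) (N M : ℕ) (h : y M ≤ N) (h0 : N < y 0) :
    ∃ i < M, y (i + 1) ≤ N ∧ N < y i := by
  induction M with
  | zero => omega
  | succ M ih =>
    rcases lt_or_ge N (y M) with h1 | h1
    · exact ⟨M, Nat.lt_succ_self M, h, h1⟩
    · obtain ⟨i, hi, h2⟩ := ih h1
      exact ⟨i, by omega, h2⟩

/-- The removed sets are uniformly sparse. -/
theorem exists_card_removed_le {a B : ℝ} (ha : 0 < a) (hB0 : 0 ≤ B) (hB1 : B ≤ 1)
    (haB : 4 * a ≤ phi B) : ∃ C : ℝ, 0 < C ∧ ∀ M : ℕ, 1 ≤ M → ∀ L : ℝ,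
    1 ≤ (a / phi B) ^ M * L → ∀ N : ℕ, 2 ≤ N →
    (((Finset.Icc 1 N).filter (· ∈ removed B (a / phi B) M L)).card : ℝ) ≤
      C * N * Real.log N ^ (-a) := by
  obtain ⟨C, hC, h⟩ := exists_card_primeCountIn_expExp_le
  refine ⟨C, hC, fun M hM L hL N hN => ?_⟩
  have hphi : 0 < phi B := by linarith
  have hphi1 : phi B ≤ 1 := (phi_bijOn.mapsTo ⟨hB0, hB1⟩).2
  set r := a / phi B with hr
  have hr0 : 0 < r := by positivity
  have hr1 : r ≤ 1 := by rw [hr, div_le_one hphi]; linarith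
  have hL0 : 0 < L := by
    by_contra hneg
    have := mul_nonpos_of_nonneg_of_nonpos (pow_pos hr0 M).le (not_lt.1 hneg)
    linarith
  have hrL : ∀ i ≤ M, 1 ≤ r ^ i * L := fun i hi =>
    hL.trans (mul_le_mul_of_nonneg_right (pow_le_pow_of_le_one hr0.le hr1 hi) hL0.le)
  have hL1 : 1 ≤ L := by simpa using hrL 0 (Nat.zero_le M)
  -- Only the condition at index i+1 is used: φ(B) r = a converts its exponent into a r^i L.
  have key : ∀ i < M, ∀ N', expExp (r ^ (i + 1) * L) ≤ N' →
      (((Finset.Icc 1 N').filter (· ∈ removed B r M L)).card : ℝ) ≤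
      C * N' * Real.exp (-(a * (r ^ i * L))) := by
    intro i hi N' hN'
    have h1 := h B hB0 hB1 (r ^ (i + 1) * L) N' (hrL (i + 1) hi) hN'
    have h2 : phi B * (r ^ (i + 1) * L) = a * (r ^ i * L) := by
      have : phi B * r = a := by rw [hr]; field_simp
      rw [pow_succ, ← this]; ring
    rw [h2] at h1
    refine le_trans (Nat.cast_le.2 (Finset.card_le_card ?_)) h1
    intro n hn
    simp only [Finset.mem_filter, mem_removed] at hn ⊢
    exact ⟨hn.1, hn.2.2 (i + 1) (by omega) hi⟩
  have conv : ∀ t : ℝ, ∀ n : ℕ, 2 ≤ n → Real.log n ≤ Real.exp t →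
      Real.exp (-(a * t)) ≤ Real.log n ^ (-a) := by
    intro t n hn hnt
    have hpos : 0 < Real.log n := Real.log_pos (by exact_mod_cast hn)
    have : Real.exp (-(a * t)) = Real.exp t ^ (-a) := by rw [← Real.exp_mul]; ring_nf
    rw [this]
    exact Real.rpow_le_rpow_of_nonpos hpos hnt (by linarith)
  rcases lt_or_ge N (expExp L) with h1 | h1
  · rcases lt_or_ge N (expExp (r ^ M * L)) with h2 | h2
    · have : (Finset.Icc 1 N).filter (· ∈ removed B r M L) = ∅ := by
        refine Finset.filter_eq_empty_iff.2 fun n hn hn' => ?_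
        have := (mem_removed.1 hn').1.1
        have := (Finset.mem_Icc.1 hn).2
        omega
      rw [this]
      have hpos : 0 < Real.log N := Real.log_pos (by exact_mod_cast hN)
      simp only [Finset.card_empty, Nat.cast_zero]
      positivity
    · obtain ⟨i, hi, h3, h4⟩ := exists_scale (fun i => expExp (r ^ i * L)) N M h2 (by simpa using h1)
      refine (key i hi N h3).trans ?_
      gcongr
      refine conv _ N hN ?_
      have h5 : 0 ≤ r ^ i * L := by positivity
      refine le_trans ?_ (log_expExp_le h5)
      exact Real.log_le_log (by exact_mod_cast (by omega : 0 < N)) (by exact_mod_cast h4.le)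
  -- Beyond `expExp L` nothing more is removed, so the count at `expExp L` serves.
  · have h2 : (Finset.Icc 1 N).filter (· ∈ removed B r M L) ⊆
        (Finset.Icc 1 (expExp L)).filter (· ∈ removed B r M L) := by
      intro n hn
      simp only [Finset.mem_filter, Finset.mem_Icc] at hn ⊢
      exact ⟨⟨hn.1.1, (mem_removed.1 hn.2).1.2⟩, hn.2⟩
    have hrL' : r ^ (0 + 1) * L ≤ L := by simpa using mul_le_of_le_one_left hL0.le hr1
    have h3 := key 0 hM (expExp L) (expExp_mono hrL')
    rw [pow_zero, one_mul] at h3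
    have h2L := two_le_expExp hL0.le
    have h4 := conv L (expExp L) h2L (log_expExp_le hL0.le)
    have hlog1 : 1 ≤ Real.log (expExp L) :=
      (Real.one_le_exp (by linarith)).trans (exp_sub_one_le_log_expExp hL1)
    have h5 := mul_log_rpow_le (a := a) (x₀ := expExp L) (x := N) (by linarith) hlog1
      (by exact_mod_cast (by omega : 0 < expExp L)) (by exact_mod_cast h1)
    calc (((Finset.Icc 1 N).filter (· ∈ removed B r M L)).card : ℝ)
        ≤ ((Finset.Icc 1 (expExp L)).filter (· ∈ removed B r M L)).card :=
          Nat.cast_le.2 (Finset.card_le_card h2)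
      _ ≤ C * expExp L * Real.exp (-(a * L)) := h3
      _ ≤ C * expExp L * Real.log (expExp L) ^ (-a) := by gcongr
      _ = C * (expExp L * Real.log (expExp L) ^ (-a)) := by ring
      _ ≤ C * (N * Real.log N ^ (-a)) := by gcongr
      _ = _ := by ring

/-! ### Asymptotics of the prescribed counts -/

theorem log_factorial_le {j : ℕ} (hj : 1 ≤ j) :
    Real.log j.factorial ≤ (j + 1) * Real.log j - j + 1 := by
  induction j, hj using Nat.le_induction with
  | base => simp
  | succ j hj ih =>
    have hj0 : (0 : ℝ) < j := by exact_mod_cast hj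
    rw [Nat.factorial_succ, Nat.cast_mul, Real.log_mul (by positivity) (by positivity)]
    have h1 : 1 / ((j : ℝ) + 1) ≤ Real.log (j + 1 : ℕ) - Real.log j := by
      rw [← Real.log_div (by positivity) hj0.ne']
      refine le_trans (le_of_eq ?_) (Real.one_sub_inv_le_log_of_pos (by positivity))
      push_cast
      field_simp
      ring
    rw [div_le_iff₀ (by positivity)] at h1
    push_cast at h1 ⊢
    nlinarith

/-- By Stirling, (δL)^j/j! with j ≈ βδL is about exp(βδL(1 - log β)), and β(1 - log β) = 1 - φ(β).
The tolerance 2 in j accommodates twice an integer part; C accommodates the Mertens error. -/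
theorem eventually_exp_le_pow_div_factorial {δ β C η : ℝ} (hδ : 0 < δ) (hβ : 0 ≤ β) (hC : 0 ≤ C)
    (hη : 0 < η) : ∀ᶠ L : ℝ in atTop, ∀ (j : ℕ) (s : ℝ), (j : ℝ) ≤ β * δ * L →
      β * δ * L - 2 ≤ j → δ * L - C ≤ s →
      Real.exp ((δ * (1 - phi β) - η) * L) ≤ s ^ j / j.factorial := by
  rcases hβ.eq_or_lt with rfl | hβ
  -- For β = 0 the count j is 0 and log β is unavailable.
  · filter_upwards [eventually_ge_atTop 0] with L hL j s hj _ _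
    have hj0 : j = 0 := by
      have : (j : ℝ) ≤ 0 := by simpa using hj
      exact_mod_cast le_antisymm this (Nat.cast_nonneg j)
    subst hj0
    rw [phi_zero]
    simp only [pow_zero, Nat.factorial_zero, Nat.cast_one, div_one]
    apply Real.exp_le_one_iff.2
    nlinarith
  set D := 2 * |1 - Real.log β| + 2 * (β * C) + 1 + |Real.log (β * δ)| with hD
  have hlog : ∀ᶠ L : ℝ in atTop, Real.log L ≤ η / 2 * L := by
    have := Real.isLittleO_log_id_atTop.bound (c := η / 2) (by positivity)
    filter_upwards [this, eventually_ge_atTop 0] with L hL hL0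
    simp only [id, Real.norm_eq_abs, abs_of_nonneg hL0] at hL
    exact (le_abs_self _).trans hL
  filter_upwards [hlog, eventually_ge_atTop (2 * C / δ), eventually_ge_atTop (3 / (β * δ)),
    eventually_ge_atTop (D / (η / 2)), eventually_gt_atTop 0] with L h1 h2 h3 h4 h0 j s hj hj' hs
  have hβδ : 0 < β * δ := by positivity
  rw [div_le_iff₀ hδ] at h2
  rw [div_le_iff₀ hβδ] at h3
  rw [div_le_iff₀ (by positivity)] at h4
  have hj1 : (1 : ℝ) ≤ j := by linarith
  have hj1' : 1 ≤ j := by exact_mod_cast hj1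
  have hδL : 0 < δ * L := by positivity
  have hspos : 0 < s := by linarith
  have hu : C / (δ * L) ≤ 1 / 2 := by rw [div_le_iff₀ hδL]; linarith
  have hu0 : 0 ≤ C / (δ * L) := by positivity
  have hlog1 : -(2 * (C / (δ * L))) ≤ Real.log (1 - C / (δ * L)) := by
    refine le_trans ?_ (Real.one_sub_inv_le_log_of_pos (by linarith))
    have : (1 - C / (δ * L))⁻¹ ≤ 1 + 2 * (C / (δ * L)) := by
      rw [inv_le_iff_one_le_mul₀ (by linarith)]; nlinarith
    linarith
  have hlogs : Real.log (δ * L) - 2 * (C / (δ * L)) ≤ Real.log s := by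
    have e1 : δ * L * (1 - C / (δ * L)) = δ * L - C := by field_simp
    have e2 : Real.log (δ * L * (1 - C / (δ * L))) ≤ Real.log s :=
      Real.log_le_log (mul_pos hδL (by linarith)) (by rw [e1]; exact hs)
    rw [Real.log_mul hδL.ne' (by linarith)] at e2
    linarith
  have hlogj : Real.log j ≤ Real.log β + Real.log (δ * L) := by
    rw [← Real.log_mul hβ.ne' hδL.ne', ← mul_assoc]
    exact Real.log_le_log (by linarith) hj
  have hlogj' : Real.log j ≤ Real.log (β * δ) + Real.log L := by
    rw [← Real.log_mul hβδ.ne' h0.ne']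
    exact Real.log_le_log (by linarith) hj
  have hjC : (j : ℝ) * (C / (δ * L)) ≤ β * C := by
    calc (j : ℝ) * (C / (δ * L)) ≤ β * δ * L * (C / (δ * L)) := by gcongr
      _ = β * C := by field_simp
  have hfac := log_factorial_le hj1'
  have hmain : (j : ℝ) * (1 - Real.log β) - 2 * (β * C) - Real.log (β * δ) - Real.log L - 1 ≤
      j * Real.log s - Real.log j.factorial := by
    have e1 : (j : ℝ) * (Real.log (δ * L) - 2 * (C / (δ * L))) ≤ j * Real.log s := by gcongr
    have e2 : (j : ℝ) * Real.log j ≤ j * (Real.log β + Real.log (δ * L)) := by gcongr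
    linarith
  have hj2 : β * δ * L * (1 - Real.log β) - 2 * |1 - Real.log β| ≤ j * (1 - Real.log β) := by
    have e1 : |(j - β * δ * L) * (1 - Real.log β)| ≤ 2 * |1 - Real.log β| := by
      rw [abs_mul]
      gcongr
      rw [abs_le]; constructor <;> linarith
    have := (abs_le.1 e1).1
    linarith
  have hpf : 0 < s ^ j / (j.factorial : ℝ) := by positivity
  rw [← Real.exp_log hpf, Real.exp_le_exp, Real.log_div (by positivity) (by positivity),
    Real.log_pow]
  have hφ : δ * (1 - phi β) * L = β * δ * L * (1 - Real.log β) := by rw [phi]; ring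
  have := le_abs_self (Real.log (β * δ))
  rw [sub_mul, hφ]
  linarith


/-! ### Many integers all of whose factorizations meet the removed set -/

/-- The prescribed number of prime factors in the window `(expExp (r^(i+2) L), expExp (r^(i+1) L)]`. -/
noncomputable def windowCount (B r L : ℝ) (i : ℕ) : ℕ :=
  (if i = 0 then 2 else 1) * ⌊B * (r ^ (i + 1) - r ^ (i + 2)) * L⌋₊

/-- The window lengths telescope upwards from the empty bottom range. The claim starts at i = 2
since the window below i = 1 holds a double quota. -/
theorem primeCountIn_le_of_window {B r L : ℝ} (hB : 0 ≤ B) (hr0 : 0 < r) (hr1 : r ≤ 1)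
    (hL : 0 ≤ L) {k N : ℕ}
    (hN : ∀ i < k, primeCountIn (expExp (r ^ (i + 2) * L)) (expExp (r ^ (i + 1) * L)) N =
      windowCount B r L i)
    (h0 : primeCountIn 0 (expExp (r ^ (k + 1) * L)) N = 0) {i : ℕ} (hi : 2 ≤ i) (hik : i ≤ k + 1) :
    (primeCountIn 0 (expExp (r ^ i * L)) N : ℝ) ≤ B * (r ^ i * L) := by
  induction hik using Nat.decreasingInduction with
  | self => rw [h0]; simp only [Nat.cast_zero]; positivity
  | of_succ i hik ih =>
    have ih := ih (by omega)
    obtain ⟨l, rfl⟩ : ∃ l, i = l + 1 := ⟨i - 1, by omega⟩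
    have hpow : r ^ (l + 2) ≤ r ^ (l + 1) := pow_le_pow_of_le_one hr0.le hr1 (by omega)
    have h1 := primeCountIn_add (Nat.zero_le _)
      (expExp_mono (mul_le_mul_of_nonneg_right hpow hL)) N
    rw [hN l (by omega), windowCount, if_neg (by omega), one_mul] at h1
    have h2 : 0 ≤ B * (r ^ (l + 1) - r ^ (l + 2)) * L :=
      mul_nonneg (mul_nonneg hB (by linarith)) hL
    have h3 := Nat.floor_le h2
    rw [← h1]
    push_cast
    have ih' : (primeCountIn 0 (expExp (r ^ (l + 2) * L)) N : ℝ) ≤ B * (r ^ (l + 2) * L) := ih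
    linarith

/-- Below the top window a divisor of N inherits the bounds of N. In the top window the double quota
2b is shared by m and n, so one of them has at most b primes there. -/
theorem mem_removed_of_mul {B r L : ℝ} (hB : 0 ≤ B) (hr0 : 0 < r) (hr1 : r ≤ 1)
    (hL : 0 ≤ L) {k N : ℕ} (hk : 1 ≤ k) (hN0 : N ≠ 0) (hNL : N ≤ expExp L)
    (hN : ∀ i < k, primeCountIn (expExp (r ^ (i + 2) * L)) (expExp (r ^ (i + 1) * L)) N =
      windowCount B r L i)
    (h0 : primeCountIn 0 (expExp (r ^ (k + 1) * L)) N = 0) {m n : ℕ} (hm : 2 ≤ m) (hn : 2 ≤ n)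
    (hmn : m * n = N) : m ∈ removed B r (k + 1) L ∨ n ∈ removed B r (k + 1) L := by
  have hle : expExp (r ^ 2 * L) ≤ expExp (r ^ 1 * L) :=
    expExp_mono (mul_le_mul_of_nonneg_right (pow_le_pow_of_le_one hr0.le hr1 (by omega)) hL)
  set b := ⌊B * (r ^ 1 - r ^ 2) * L⌋₊ with hb
  have hw : 0 ≤ B * (r ^ 1 - r ^ 2) * L :=
    mul_nonneg (mul_nonneg hB (sub_nonneg.2 (pow_le_pow_of_le_one hr0.le hr1 (by omega)))) hL
  have key : ∀ d : ℕ, 2 ≤ d → d ∣ N →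
      primeCountIn (expExp (r ^ 2 * L)) (expExp (r ^ 1 * L)) d ≤ b → d ∈ removed B r (k + 1) L := by
    intro d hd hdN hdb
    have hd0 : d ≠ 0 := by omega
    refine mem_removed.2 ⟨⟨?_, (Nat.le_of_dvd (Nat.pos_of_ne_zero hN0) hdN).trans hNL⟩, ?_⟩
    -- A divisor d ≥ 2 that is too small would have a prime factor up to the bottom scale, but N has
    -- none.
    · by_contra hlt
      obtain ⟨p, hp, hpd⟩ := Nat.exists_prime_and_dvd (by omega : d ≠ 1)
      have h1 := one_le_primeCountIn (u := 0) (v := expExp (r ^ (k + 1) * L)) hp hN0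
        (hpd.trans hdN) hp.pos ((Nat.le_of_dvd (by omega) hpd).trans (not_lt.1 hlt))
      omega
    · have hge2 : ∀ i, 2 ≤ i → i ≤ k + 1 →
          (primeCountIn 0 (expExp (r ^ i * L)) d : ℝ) ≤ B * (r ^ i * L) := fun i hi hik =>
        (Nat.cast_le.2 (primeCountIn_le_of_dvd _ _ hdN hN0)).trans
          (primeCountIn_le_of_window hB hr0 hr1 hL hN h0 hi hik)
      intro i hi hik
      rcases hi.eq_or_lt with rfl | hi
      · rw [← primeCountIn_add (Nat.zero_le _) hle d]
        have h2 := hge2 2 le_rfl (by omega)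
        have h3 : ((primeCountIn (expExp (r ^ 2 * L)) (expExp (r ^ 1 * L)) d : ℕ) : ℝ) ≤
            B * (r ^ 1 - r ^ 2) * L := (Nat.cast_le.2 hdb).trans (Nat.floor_le hw)
        push_cast
        linarith
      · exact hge2 i hi hik
  have h2b := hN 0 (by omega)
  rw [windowCount, if_pos rfl, ← hmn, primeCountIn_mul _ _ (by omega) (by omega)] at h2b
  simp only [zero_add] at h2b
  rcases le_total (primeCountIn (expExp (r ^ 2 * L)) (expExp (r ^ 1 * L)) m)
    (primeCountIn (expExp (r ^ 2 * L)) (expExp (r ^ 1 * L)) n) with h | h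
  · exact Or.inl (key m hm (hmn ▸ Dvd.intro _ rfl) (by omega))
  · exact Or.inr (key n hn (hmn ▸ Dvd.intro_left _ rfl) (by omega))

/-- Bounds the size of the window part: at most 2L primes, each at most `expExp (r * L)`. -/
theorem sum_windowCount_le {B r L : ℝ} (hB0 : 0 ≤ B) (hB1 : B ≤ 1) (hr0 : 0 < r) (hr1 : r ≤ 1)
    (hL : 0 ≤ L) (k : ℕ) :
    ((∑ i ∈ Finset.range k, windowCount B r L i : ℕ) : ℝ) ≤ 2 * L := by
  have h1 : ∀ k, ((∑ i ∈ Finset.range k, windowCount B r L i : ℕ) : ℝ) ≤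
      2 * (r - r ^ (k + 1)) * L := by
    intro k
    induction k with
    | zero => simp
    | succ k ih =>
      rw [Finset.sum_range_succ, Nat.cast_add]
      have hpow : r ^ (k + 2) ≤ r ^ (k + 1) := pow_le_pow_of_le_one hr0.le hr1 (by omega)
      have hw : 0 ≤ (r ^ (k + 1) - r ^ (k + 2)) * L := mul_nonneg (by linarith) hL
      have h2 : (⌊B * (r ^ (k + 1) - r ^ (k + 2)) * L⌋₊ : ℝ) ≤
          (r ^ (k + 1) - r ^ (k + 2)) * L := by
        rw [mul_assoc]
        exact (Nat.floor_le (by positivity)).trans (mul_le_of_le_one_left hw hB1)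
      have h3 : (windowCount B r L k : ℝ) ≤ 2 * ((r ^ (k + 1) - r ^ (k + 2)) * L) := by
        rw [windowCount]
        split_ifs <;> push_cast <;> linarith
      linarith
  refine (h1 k).trans ?_
  have : 0 ≤ r ^ (k + 1) := by positivity
  gcongr
  linarith

/-- Size conditions on the parameters of the construction. -/
theorem eventually_size {r : ℝ} (hr1 : r ≤ 1 / 4) (n₀ : ℕ) :
    ∀ᶠ L : ℝ in atTop, ∀ J e : ℕ, (J : ℝ) ≤ 2 * L →
      e ≤ expExp (L - 2) * expExp (r ^ 1 * L) ^ J → e ≠ 0 →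
      n₀ ≤ expExp L / e ∧ 8 * expExp (r ^ 1 * L) ≤ expExp L / e ∧ 1 ≤ expExp L / e := by
  have hexp : Tendsto (fun L : ℝ => Real.exp (L / 2)) atTop atTop :=
    Real.tendsto_exp_atTop.comp (tendsto_id.atTop_div_const (by norm_num))
  have hlin : ∀ᶠ L : ℝ in atTop, 2 * L ≤ Real.exp (L / 2) := by
    have h := (Real.isLittleO_pow_exp_atTop (n := 1)).bound (c := 1 / 4) (by norm_num)
    have h' := (tendsto_id.atTop_div_const (by norm_num : (0 : ℝ) < 2)).eventually h
    filter_upwards [h', eventually_ge_atTop 0] with L hL hL0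
    simp only [id, pow_one, Real.norm_eq_abs, abs_of_nonneg (by positivity : 0 ≤ L / 2),
      abs_of_nonneg (Real.exp_pos _).le] at hL
    linarith
  filter_upwards [hlin, eventually_ge_atTop 8, hexp.eventually_ge_atTop (9 + n₀ : ℝ)]
    with L h1 hL8 h2 J e hJ he he0
  set w := expExp (r ^ 1 * L) with hw
  have hE : Real.exp (r ^ 1 * L) ≤ Real.exp (L / 4) := by
    rw [Real.exp_le_exp, pow_one]; nlinarith
  have hw1 : (w : ℝ) ≤ Real.exp (Real.exp (L / 4)) :=
    (expExp_le _).trans (Real.exp_le_exp.2 hE)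
  have hS : Real.exp (L / 4) ≤ Real.exp (L - 2) := Real.exp_le_exp.2 (by linarith)
  have hprod : Real.exp (L / 2) * Real.exp (L / 4) ≤ Real.exp (L - 2) := by
    rw [← Real.exp_add, Real.exp_le_exp]; linarith
  have hwJ : (w : ℝ) ^ J ≤ Real.exp (Real.exp (L - 2)) := by
    calc (w : ℝ) ^ J ≤ Real.exp (Real.exp (L / 4)) ^ J := by gcongr
      _ = Real.exp (J * Real.exp (L / 4)) := by rw [← Real.exp_nat_mul]
      _ ≤ _ := by
        rw [Real.exp_le_exp]
        refine le_trans ?_ hprod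
        gcongr
        linarith
  have hn₀ : (9 + n₀ : ℝ) ≤ Real.exp (Real.exp (L - 2)) := by
    refine h2.trans (Real.exp_le_exp.2 ?_)
    linarith [Real.add_one_le_exp (L - 2)]
  have he' : (e : ℝ) ≤ Real.exp (Real.exp (L - 2)) * Real.exp (Real.exp (L - 2)) := by
    calc (e : ℝ) ≤ (expExp (L - 2) : ℝ) * (w : ℝ) ^ J := by exact_mod_cast he
      _ ≤ _ := by gcongr; exact expExp_le _
  have hw3 : (w : ℝ) ≤ Real.exp (Real.exp (L - 2)) := hw1.trans (Real.exp_le_exp.2 hS)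
  have h1E : (1 : ℝ) ≤ Real.exp (Real.exp (L - 2)) := Real.one_le_exp (Real.exp_pos _).le
  have hbig : ((8 * w + n₀ + 1 : ℕ) : ℝ) * e ≤ expExp L := by
    have e1 : ((8 * w + n₀ + 1 : ℕ) : ℝ) ≤
        Real.exp (Real.exp (L - 2)) * Real.exp (Real.exp (L - 2)) := by
      push_cast
      have hn0 : (0 : ℝ) ≤ n₀ := Nat.cast_nonneg _
      calc (8 * w + n₀ + 1 : ℝ) ≤ (9 + n₀) * Real.exp (Real.exp (L - 2)) := by nlinarith
        _ ≤ _ := by gcongr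
    have e2 : ((8 * w + n₀ + 1 : ℕ) : ℝ) * e ≤
        Real.exp (4 * Real.exp (L - 2)) := by
      have : Real.exp (4 * Real.exp (L - 2)) = (Real.exp (Real.exp (L - 2)) *
          Real.exp (Real.exp (L - 2))) * (Real.exp (Real.exp (L - 2)) *
          Real.exp (Real.exp (L - 2))) := by
        simp only [← Real.exp_add]; ring_nf
      rw [this]
      gcongr
    -- The reason for stopping the rough part at L - 2: since e² > 5, the four factors exp(exp(L-2))
    -- and the rounding factor 2 fit below exp(exp L).
    have e3 : 5 * Real.exp (L - 2) ≤ Real.exp L := by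
      have : Real.exp L = Real.exp (L - 2) * (Real.exp 1 * Real.exp 1) := by
        simp only [← Real.exp_add]; ring_nf
      have h5 : 5 ≤ Real.exp 1 * Real.exp 1 := by nlinarith [Real.exp_one_gt_d9]
      have := Real.exp_pos (L - 2)
      nlinarith
    refine e2.trans (le_trans ?_ (half_exp_exp_le (by linarith)))
    rw [le_div_iff₀ (by norm_num)]
    have e4 : (2 : ℝ) ≤ Real.exp (Real.exp (L - 2)) := by
      have := Real.add_one_le_exp (Real.exp (L - 2))
      have := Real.add_one_le_exp (L - 2)
      linarith
    calc Real.exp (4 * Real.exp (L - 2)) * 2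
        ≤ Real.exp (4 * Real.exp (L - 2)) * Real.exp (Real.exp (L - 2)) := by gcongr
      _ = Real.exp (5 * Real.exp (L - 2)) := by rw [← Real.exp_add]; ring_nf
      _ ≤ _ := Real.exp_le_exp.2 e3
  have hfin : 8 * w + n₀ + 1 ≤ expExp L / e :=
    (Nat.le_div_iff_mul_le (Nat.pos_of_ne_zero he0)).2 (by exact_mod_cast hbig)
  omega

/-- Lower bound for the number of integers with the prescribed window counts. -/
theorem eventually_exists_windowed {B r : ℝ} (hB0 : 0 ≤ B) (hB1 : B ≤ 1) (hr0 : 0 < r)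
    (hr1 : r ≤ 1 / 4) {k : ℕ} (hk : 1 ≤ k) {η : ℝ} (hη : 0 < η) :
    ∀ᶠ L : ℝ in atTop, ∃ S : Finset ℕ,
      (∀ N ∈ S, N ≠ 0 ∧ N ≤ expExp L ∧
        (∀ i < k, primeCountIn (expExp (r ^ (i + 2) * L)) (expExp (r ^ (i + 1) * L)) N =
          windowCount B r L i) ∧ primeCountIn 0 (expExp (r ^ (k + 1) * L)) N = 0) ∧
      (expExp L : ℝ) * Real.exp ((-r + (r - r ^ 2) * (1 - phi (2 * B)) +
        (r ^ 2 - r ^ (k + 1)) * (1 - phi B) - (k + 1) * η) * L) ≤ S.card := by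
  obtain ⟨C, hC, hmert⟩ := exists_abs_primeRecip_sub_le
  obtain ⟨c, hc, hrough⟩ := exists_le_sum_roughUpTo
  obtain ⟨n₀, hcard⟩ := exists_le_card_largePrimeMul
  have hr1' : r ≤ 1 := by linarith
  have hr1'' : r < 1 := by linarith
  set β : ℕ → ℝ := fun i => if i = 0 then 2 * B else B with hβ
  have hβ0 : ∀ i, 0 ≤ β i := fun i => by simp only [hβ]; split_ifs <;> linarith
  set δ : ℕ → ℝ := fun i => r ^ (i + 1) - r ^ (i + 2) with hδ
  have hδ0 : ∀ i, 0 < δ i := fun i => sub_pos.2 (pow_lt_pow_right_of_lt_one₀ hr0 hr1'' (by omega))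
  have hfac : ∀ᶠ L : ℝ in atTop, ∀ i ∈ Finset.range k, ∀ (j : ℕ) (s : ℝ),
      (j : ℝ) ≤ β i * δ i * L → β i * δ i * L - 2 ≤ j → δ i * L - (C + 1) ≤ s →
      Real.exp ((δ i * (1 - phi (β i)) - η) * L) ≤ s ^ j / j.factorial :=
    (Filter.eventually_all_finset _).2 fun i _ =>
      eventually_exp_le_pow_div_factorial (hδ0 i) (hβ0 i) (by linarith) hη
  -- All multiplicative constants are absorbed by one extra η, beyond the k used for the windows.
  have hconst : ∀ᶠ L : ℝ in atTop, Real.exp (-(η * L)) ≤ c * Real.exp (-3) / 8 := by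
    have : Tendsto (fun L : ℝ => Real.exp (-(η * L))) atTop (𝓝 0) :=
      Real.tendsto_exp_neg_atTop_nhds_zero.comp (tendsto_id.const_mul_atTop hη)
    exact (this.eventually_lt_const (by positivity)).mono fun _ h => h.le
  have hbase : ∀ᶠ L : ℝ in atTop, 1 ≤ r ^ (k + 1) * L :=
    (tendsto_id.const_mul_atTop (pow_pos hr0 (k + 1))).eventually_ge_atTop 1
  filter_upwards [hfac, hconst, hbase, eventually_size hr1 n₀, eventually_ge_atTop 3]
    with L hfac hconst hbase hsize hL3
  have hL0 : 0 < L := by linarith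
  set y : ℕ → ℕ := fun i => expExp (r ^ i * L) with hydef
  have hy : Antitone y := fun i j hij => expExp_mono
    (mul_le_mul_of_nonneg_right (pow_le_pow_of_le_one hr0.le hr1' hij) hL0.le)
  have hrL : ∀ i ≤ k + 1, 1 ≤ r ^ i * L := fun i hi =>
    hbase.trans (mul_le_mul_of_nonneg_right (pow_le_pow_of_le_one hr0.le hr1' hi) hL0.le)
  have hy2 : ∀ i ≤ k + 1, 2 ≤ y i := fun i hi => two_le_expExp (by linarith [hrL i hi])
  obtain ⟨E, hE, hEsum⟩ := exists_prescribed hy (windowCount B r L) (expExp (L - 2)) k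
  have hJ := sum_windowCount_le hB0 hB1 hr0 hr1' hL0.le k
  have hX1 : 1 ≤ expExp L := (by omega : 1 ≤ 2).trans (two_le_expExp hL0.le)
  have hcount := hcard (y 1) (expExp L) E hX1 fun e he =>
    ⟨(hE e he).1, hsize _ e hJ (hE e he).2.1 (hE e he).1⟩
  refine ⟨largePrimeMul (y 1) (expExp L) E, fun N hN => ?_, ?_⟩
  · obtain ⟨⟨e, p⟩, hx, rfl⟩ := Finset.mem_image.1 hN
    simp only [Finset.mem_sigma, Finset.mem_filter, Finset.mem_Ioc] at hx ⊢
    obtain ⟨he, ⟨hp1, hpX⟩, hpp⟩ := hx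
    obtain ⟨he0, -, hei, hek⟩ := hE e he
    have hpz : ∀ u v, v ≤ y 1 → primeCountIn u v p = 0 := fun u v hv => by
      rw [primeCountIn_prime u v hpp, if_neg]
      simp only [Finset.mem_Ioc]; omega
    refine ⟨mul_ne_zero he0 hpp.ne_zero, ?_, fun i hi => ?_, ?_⟩
    · rw [mul_comm]; exact (Nat.le_div_iff_mul_le (Nat.pos_of_ne_zero he0)).1 hpX
    · rw [primeCountIn_mul _ _ he0 hpp.ne_zero, hpz _ _ (hy (by omega)), add_zero]
      exact hei i hi
    · rw [primeCountIn_mul _ _ he0 hpp.ne_zero, hpz _ _ (hy (by omega)), add_zero]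
      exact hek
  · have hprod : Real.exp (∑ i ∈ Finset.range k, (δ i * (1 - phi (β i)) - η) * L) ≤
        ∏ i ∈ Finset.range k, primeRecip (y (i + 2)) (y (i + 1)) ^ windowCount B r L i /
          (windowCount B r L i).factorial := by
      rw [Real.exp_sum]
      refine Finset.prod_le_prod (fun _ _ => (Real.exp_pos _).le) fun i hi => ?_
      have hik := Finset.mem_range.1 hi
      have hw0 : 0 ≤ B * δ i * L := mul_nonneg (mul_nonneg hB0 (hδ0 i).le) hL0.le
      have f1 := Nat.floor_le hw0
      have f2 := Nat.lt_floor_add_one (B * δ i * L)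
      refine hfac i hi _ _ ?_ ?_ ?_
      · simp only [windowCount, hβ]
        simp only [hδ] at f1 ⊢
        split_ifs <;> push_cast <;> linarith
      · simp only [windowCount, hβ]
        simp only [hδ] at f2 ⊢
        split_ifs <;> push_cast <;> linarith
      · have g1 := (abs_le.1 (hmert (y (i + 2)) (y (i + 1)) (hy2 _ (by omega))
          (hy (by omega)))).1
        have g2 := le_log_log_expExp (hrL (i + 1) (by omega))
        have g3 := log_log_expExp_le (hrL (i + 2) (by omega))
        simp only [hδ, hydef] at g1 ⊢
        linarith
    have hsum : ∑ i ∈ Finset.range k, (δ i * (1 - phi (β i)) - η) * L =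
        ((r - r ^ 2) * (1 - phi (2 * B)) + (r ^ 2 - r ^ (k + 1)) * (1 - phi B) - k * η) * L := by
      clear * - hk hδ hβ
      induction k, hk using Nat.le_induction with
      | base => simp [hδ, hβ]
      | succ k hk ih =>
        rw [Finset.sum_range_succ, ih]
        simp only [hδ, hβ, if_neg (by omega : k ≠ 0)]
        push_cast
        ring
    rw [hsum] at hprod
    have hY1 : 1 ≤ expExp (L - 2) := (by omega : 1 ≤ 2).trans (two_le_expExp (by linarith))
    have hR := hrough (y 1) (expExp (L - 2)) (hy2 1 (by omega)) hY1
    have hlogY : Real.exp (L - 3) ≤ Real.log (expExp (L - 2)) := by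
      have := exp_sub_one_le_log_expExp (t := L - 2) (by linarith)
      rwa [show L - 2 - 1 = L - 3 by ring] at this
    have hll : Real.exp (-(r * L)) ≤ Real.exp (-Real.log (Real.log (y 1))) := by
      have := log_log_expExp_le (hrL 1 (by omega))
      rw [Real.exp_le_exp]
      simp only [hydef]
      rw [pow_one] at this ⊢
      linarith
    have hR2 : c * Real.exp (L - 3) * Real.exp (-(r * L)) ≤
        ∑ q ∈ roughUpTo (y 1) (expExp (L - 2)), 1 / (q : ℝ) := by
      refine le_trans ?_ hR
      gcongr
    set P := ((r - r ^ 2) * (1 - phi (2 * B)) + (r ^ 2 - r ^ (k + 1)) * (1 - phi B) - k * η) * L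
      with hP
    have hE2 : Real.exp P * (c * Real.exp (L - 3) * Real.exp (-(r * L))) ≤
        ∑ e ∈ E, 1 / (e : ℝ) := by
      refine le_trans ?_ hEsum
      have : 0 ≤ Real.exp P := (Real.exp_pos _).le
      exact mul_le_mul hprod hR2 (by positivity) (this.trans hprod)
    have hlogX := log_expExp_le hL0.le
    -- The factor log X ≤ e^L cancels the factor log Y ≥ e^(L-3) from the rough integers, up to a
    -- constant.
    have hfin : (expExp L : ℝ) / 8 * (Real.exp P * (c * Real.exp (L - 3) * Real.exp (-(r * L)))) ≤
        ((largePrimeMul (y 1) (expExp L) E).card : ℝ) * Real.exp L := by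
      calc _ ≤ (expExp L : ℝ) / 8 * ∑ e ∈ E, 1 / (e : ℝ) := by gcongr
        _ ≤ _ := hcount
        _ ≤ _ := by gcongr
    refine le_of_mul_le_mul_right (le_trans ?_ hfin) (Real.exp_pos L)
    have e1 : Real.exp (L - 3) = Real.exp (-3) * Real.exp L := by rw [← Real.exp_add]; ring_nf
    have e2 : Real.exp ((-r + (r - r ^ 2) * (1 - phi (2 * B)) +
        (r ^ 2 - r ^ (k + 1)) * (1 - phi B) - (k + 1) * η) * L) =
        Real.exp P * Real.exp (-(r * L)) * Real.exp (-(η * L)) := by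
      rw [← Real.exp_add, ← Real.exp_add, hP]; ring_nf
    rw [e1, e2]
    calc (expExp L : ℝ) * (Real.exp P * Real.exp (-(r * L)) * Real.exp (-(η * L))) * Real.exp L
        ≤ (expExp L : ℝ) * (Real.exp P * Real.exp (-(r * L)) * (c * Real.exp (-3) / 8)) *
          Real.exp L := by gcongr
      _ = _ := by ring


/-! ### The set `A` -/

open Classical in
theorem R_eq {x : ℝ} (hx : 0 < x) (A : Set ℕ) : R x A =
    ((x - ⌊x⌋₊) + ((Finset.Icc 1 ⌊x⌋₊).filter (· ∉ A)).card) / x := by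
  have h1 : {n : ℕ | n ∈ A ∧ 1 ≤ n ∧ (n : ℝ) ≤ x} =
      ((Finset.Icc 1 ⌊x⌋₊).filter (· ∈ A) : Finset ℕ) := by
    ext n
    simp only [mem_ofPred_eq, Finset.coe_filter, Finset.mem_Icc, Nat.le_floor_iff hx.le]
    tauto
  have h2 := Finset.card_filter_add_card_filter_not (s := Finset.Icc 1 ⌊x⌋₊) (· ∈ A)
  rw [Nat.card_Icc, Nat.add_sub_cancel] at h2
  have h3 : (((Finset.Icc 1 ⌊x⌋₊).filter (· ∈ A)).card : ℝ) +
      ((Finset.Icc 1 ⌊x⌋₊).filter (· ∉ A)).card = ⌊x⌋₊ := by exact_mod_cast h2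
  rw [R, h1, Set.ncard_coe_finset, ← h3]
  field_simp
  ring

theorem R_nonneg {x : ℝ} (hx : 0 < x) (A : Set ℕ) : 0 ≤ R x A := by
  classical
  rw [R_eq hx]
  have := Nat.floor_le hx.le
  exact div_nonneg (add_nonneg (by linarith) (Nat.cast_nonneg _)) hx.le

/-- The terms 1 and √N make room for the integer 1 and for older removed sets. They are harmless
because √x ≪ x/log x ≤ x (log x)^(-a) when a ≤ 1. -/
theorem R_isBigO {A : Set ℕ} {a C : ℝ} (ha0 : 0 ≤ a) (ha1 : a ≤ 1) (hC : 0 ≤ C)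
    (hA : ∀ N : ℕ, 2 ≤ N → ∃ F : Finset ℕ, (∀ n, 1 ≤ n → n ≤ N → n ∉ A → n ∈ F) ∧
      (F.card : ℝ) ≤ 1 + √N + C * N * Real.log N ^ (-a)) :
    (fun x : ℝ => R x A) =O[atTop] (fun x : ℝ => (Real.log x) ^ (-a)) := by
  classical
  refine IsBigO.of_bound (6 + 2 * C) ?_
  filter_upwards [eventually_ge_atTop 4] with x hx
  have hx0 : 0 < x := by linarith
  have hlog1 : 1 ≤ Real.log x := by
    rw [Real.le_log_iff_exp_le hx0]; linarith [Real.exp_one_lt_d9]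
  have hlog0 : 0 < Real.log x := by linarith
  set N := ⌊x⌋₊ with hN
  have hNx : (N : ℝ) ≤ x := Nat.floor_le hx0.le
  have hxN : x < N + 1 := Nat.lt_floor_add_one x
  have hN2 : 2 ≤ N := Nat.le_floor (by push_cast; linarith)
  obtain ⟨F, hF1, hF2⟩ := hA N hN2
  have hcard : (((Finset.Icc 1 N).filter (· ∉ A)).card : ℝ) ≤
      1 + √N + C * N * Real.log N ^ (-a) := by
    refine le_trans (Nat.cast_le.2 (Finset.card_le_card fun n hn => ?_)) hF2
    simp only [Finset.mem_filter, Finset.mem_Icc] at hn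
    exact hF1 n hn.1.1 hn.1.2 hn.2
  have hsx : 2 ≤ √x := Real.le_sqrt_of_sq_le (by linarith)
  have hxx : √x * √x = x := Real.mul_self_sqrt hx0.le
  have hlogN : Real.log x / 2 ≤ Real.log N := by
    rw [← Real.log_sqrt hx0.le]
    exact Real.log_le_log (by linarith) (by nlinarith)
  have hpow : Real.log N ^ (-a) ≤ 2 * Real.log x ^ (-a) := by
    calc Real.log N ^ (-a) ≤ (Real.log x / 2) ^ (-a) :=
          Real.rpow_le_rpow_of_nonpos (by linarith) hlogN (by linarith)
      _ = 2 ^ a * Real.log x ^ (-a) := by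
          rw [Real.div_rpow hlog0.le (by norm_num), Real.rpow_neg (by norm_num : (0 : ℝ) ≤ 2)]
          field_simp
      _ ≤ 2 ^ (1 : ℝ) * Real.log x ^ (-a) := by
          gcongr
          norm_num
      _ = _ := by rw [Real.rpow_one]
  have hsq : 3 * √x ≤ 6 * x * Real.log x ^ (-a) := by
    have h1 : Real.log x ≤ 2 * √x := by
      have := Real.log_le_sub_one_of_pos (by linarith : 0 < √x)
      rw [Real.log_sqrt hx0.le] at this
      linarith
    have h2 : (Real.log x)⁻¹ ≤ Real.log x ^ (-a) := by
      rw [← Real.rpow_neg_one]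
      exact Real.rpow_le_rpow_of_exponent_le hlog1 (by linarith)
    have h3 : √x ≤ 2 * x * (Real.log x)⁻¹ := by
      rw [← div_eq_mul_inv, le_div_iff₀ hlog0]
      nlinarith
    have h4 : 2 * x * (Real.log x)⁻¹ ≤ 2 * x * Real.log x ^ (-a) := by gcongr
    linarith
  rw [Real.norm_of_nonneg (R_nonneg hx0 A), Real.norm_of_nonneg (by positivity), R_eq hx0,
    div_le_iff₀ hx0]
  have hsN : √(N : ℝ) ≤ √x := Real.sqrt_le_sqrt hNx
  have hCN : C * N * Real.log N ^ (-a) ≤ C * x * (2 * Real.log x ^ (-a)) := by gcongr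
  linarith

theorem R_tendsto_zero {A : Set ℕ} {a : ℝ} (ha : 0 < a)
    (h : (fun x : ℝ => R x A) =O[atTop] (fun x : ℝ => (Real.log x) ^ (-a))) :
    Tendsto (fun x : ℝ => R x A) atTop (𝓝 0) :=
  h.trans_tendsto ((tendsto_rpow_neg_atTop ha).comp Real.tendsto_log_atTop)

theorem IsOmega.of_sequence {A : Set ℕ} {E : ℝ} (hE : 0 ≤ E) {L : ℕ → ℝ}
    (hL : Tendsto L atTop atTop)
    (h : ∀ q, ∃ S : Finset ℕ, (∀ N ∈ S, 1 ≤ N ∧ N ≤ expExp (L q) ∧ N ∉ A) ∧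
      (expExp (L q) : ℝ) * Real.exp (-E * L q) ≤ S.card) :
    IsOmega (fun x : ℝ => R x A) (fun x : ℝ => (Real.log x) ^ (-E)) := by
  classical
  -- The constant pays for knowing only log x ≥ exp(L - 1) at x = `expExp L`.
  refine ⟨Real.exp (-E), Real.exp_pos _, ?_⟩
  have hx : Tendsto (fun q => (expExp (L q) : ℝ)) atTop atTop :=
    tendsto_natCast_atTop_atTop.comp (tendsto_expExp.comp hL)
  refine hx.frequently (Eventually.frequently ?_)
  filter_upwards [hL.eventually_ge_atTop 1] with q hq
  obtain ⟨S, hS, hcard⟩ := h q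
  have h2 : (2 : ℝ) ≤ expExp (L q) := by exact_mod_cast two_le_expExp (by linarith)
  have hx0 : (0 : ℝ) < expExp (L q) := by linarith
  have hlog := exp_sub_one_le_log_expExp hq
  have hlog0 : 0 < Real.log (expExp (L q)) := (Real.exp_pos _).trans_le hlog
  rw [abs_of_nonneg (R_nonneg hx0 A), abs_of_nonneg (by positivity), R_eq hx0, Nat.floor_natCast,
    sub_self, zero_add, le_div_iff₀ hx0]
  have h3 : Real.log (expExp (L q)) ^ (-E) ≤ Real.exp (L q - 1) ^ (-E) :=
    Real.rpow_le_rpow_of_nonpos (Real.exp_pos _) hlog (by linarith)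
  have h4 : Real.exp (-E) * Real.exp (L q - 1) ^ (-E) = Real.exp (-E * L q) := by
    rw [← Real.exp_mul, ← Real.exp_add]; ring_nf
  have h5 : (S.card : ℝ) ≤ ((Finset.Icc 1 (expExp (L q))).filter (· ∉ A)).card := by
    refine Nat.cast_le.2 (Finset.card_le_card fun n hn => ?_)
    simp only [Finset.mem_filter, Finset.mem_Icc]
    exact ⟨⟨(hS n hn).1, (hS n hn).2.1⟩, (hS n hn).2.2⟩
  calc Real.exp (-E) * Real.log (expExp (L q)) ^ (-E) * expExp (L q)
      ≤ Real.exp (-E) * Real.exp (L q - 1) ^ (-E) * expExp (L q) := by gcongr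
    _ = expExp (L q) * Real.exp (-E * L q) := by rw [h4, mul_comm]
    _ ≤ _ := hcard.trans h5

/-- If the scales `L q` grow fast enough, then up to `N` at most one removed set matters. -/
theorem exists_removed_or_sq_le {B r : ℝ} {M : ℕ} (hr0 : 0 < r) {L : ℕ → ℝ} (hL1 : ∀ q, 1 ≤ L q)
    (hmono : Monotone L) (htop : Tendsto L atTop atTop) (hgrow : ∀ q, 2 * L q ≤ r ^ M * L (q + 1))
    (N : ℕ) : ∃ q, ∀ n ≤ N, ∀ q', n ∈ removed B r M (L q') → n ^ 2 ≤ N ∨ n ∈ removed B r M (L q) := by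
  have hrM : 0 < r ^ M := pow_pos hr0 M
  have hmono' : Monotone fun q => expExp (r ^ M * L q) := fun p q hpq =>
    expExp_mono (mul_le_mul_of_nonneg_left (hmono hpq) hrM.le)
  have hex : ∃ q, N < expExp (r ^ M * L q) :=
    ((tendsto_expExp.comp (htop.const_mul_atTop hrM)).eventually_gt_atTop N).exists
  classical
  have hfind := Nat.find_spec hex
  have hmin := fun q => Nat.find_min hex (m := q)
  -- The relevant q is the last scale whose removed set begins at or below N. Later sets begin
  -- beyond N, and elements of earlier ones are at most √N.
  rcases hq0 : Nat.find hex with _ | q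
  · rw [hq0] at hfind
    refine ⟨0, fun n hn q' hq' => ?_⟩
    have h1 := (mem_removed.1 hq').1.1
    have h2 : expExp (r ^ M * L 0) ≤ expExp (r ^ M * L q') := hmono' (Nat.zero_le q')
    omega
  · rw [hq0] at hfind hmin
    refine ⟨q, fun n hn q' hq' => ?_⟩
    rcases lt_trichotomy q' q with h | rfl | h
    · left
      have h1 := (mem_removed.1 hq').1.2
      calc n ^ 2 ≤ expExp (L q') ^ 2 := Nat.pow_le_pow_left h1 2
        _ ≤ expExp (2 * L q') := expExp_sq_le (hL1 q')
        _ ≤ expExp (r ^ M * L (q' + 1)) := expExp_mono (hgrow q')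
        _ ≤ expExp (r ^ M * L q) := hmono' h
        _ ≤ N := not_lt.1 (hmin q (Nat.lt_succ_self q))
    · exact Or.inr hq'
    · have h1 := (mem_removed.1 hq').1.1
      have h2 : expExp (r ^ M * L (q + 1)) ≤ expExp (r ^ M * L q') := hmono' h
      omega

/-- The main construction: sets with small defect whose product set has large defect. -/
theorem exists_set_of_phi {a B : ℝ} (ha : 0 < a) (hB0 : 0 ≤ B) (hB1 : B ≤ 1)
    (haB : 4 * a ≤ phi B) {E : ℝ} (hE0 : 0 ≤ E)
    (hE : phi B * (a / phi B) ^ 2 + phi (2 * B) * (a / phi B - (a / phi B) ^ 2) < E) :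
    ∃ A : Set ℕ, (fun x : ℝ => R x A) =O[atTop] (fun x : ℝ => (Real.log x) ^ (-a)) ∧
      IsOmega (fun x : ℝ => R x (A * A)) (fun x : ℝ => (Real.log x) ^ (-E)) := by
  classical
  have hphi : 0 < phi B := by linarith
  have hphi1 : phi B ≤ 1 := (phi_bijOn.mapsTo ⟨hB0, hB1⟩).2
  obtain ⟨C, hC, hsparse⟩ := exists_card_removed_le ha hB0 hB1 haB
  set r := a / phi B with hr
  have hr0 : 0 < r := by positivity
  have hr1 : r ≤ 1 / 4 := by rw [hr, div_le_iff₀ hphi]; linarith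
  set ε := E - (phi B * r ^ 2 + phi (2 * B) * (r - r ^ 2)) with hε
  have hε0 : 0 < ε := by linarith
  -- Requiring no prime factor at all below the bottom scale costs at most r^(k+1) in the exponent;
  -- this takes half of ε, and the errors η take the other half.
  obtain ⟨k₀, hk₀⟩ := exists_pow_lt_of_lt_one (by positivity : 0 < ε / 2) (by linarith : r < 1)
  set k := k₀ + 1 with hk
  have hrk : r ^ (k + 1) ≤ ε / 2 :=
    (pow_le_pow_of_le_one hr0.le (by linarith) (by omega)).trans hk₀.le
  set η := ε / (2 * (k + 1)) with hη
  have hη0 : 0 < η := by positivity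
  have hkη : (k + 1) * η = ε / 2 := by rw [hη]; field_simp
  have hexp : -E ≤ -r + (r - r ^ 2) * (1 - phi (2 * B)) +
      (r ^ 2 - r ^ (k + 1)) * (1 - phi B) - (k + 1) * η := by
    rw [hkη]
    have : 0 ≤ r ^ (k + 1) * phi B := by positivity
    linarith
  have hwin := eventually_exists_windowed hB0 hB1 hr0 hr1 (by omega : 1 ≤ k) hη0
  have hrM : 0 < r ^ (k + 1) := by positivity
  have hbase : ∀ᶠ L : ℝ in atTop, 1 ≤ r ^ (k + 1) * L :=
    (tendsto_id.const_mul_atTop hrM).eventually_ge_atTop 1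
  obtain ⟨L₀, hL₀⟩ := eventually_atTop.1 ((hwin.and hbase).and (eventually_ge_atTop 1))
  have hL₀1 : 1 ≤ L₀ := (hL₀ L₀ le_rfl).2
  -- The ratio making 2 L(q) = r^(k+1) L(q+1), as the separation of the scales demands.
  set Q := 2 / r ^ (k + 1) with hQ
  have hQ2 : 2 ≤ Q := by
    rw [hQ, le_div_iff₀ hrM]
    have : r ^ (k + 1) ≤ 1 := pow_le_one₀ hr0.le (by linarith)
    linarith
  set L : ℕ → ℝ := fun q => L₀ * Q ^ q with hL
  have hmono : Monotone L := fun p q hpq => by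
    simp only [hL]
    have : Q ^ p ≤ Q ^ q := pow_le_pow_right₀ (by linarith) hpq
    gcongr
  have hLge : ∀ q, L₀ ≤ L q := fun q => by simpa [hL] using hmono (Nat.zero_le q)
  have htop : Tendsto L atTop atTop :=
    (tendsto_pow_atTop_atTop_of_one_lt (by linarith : 1 < Q)).const_mul_atTop (by linarith)
  have hgrow : ∀ q, 2 * L q ≤ r ^ (k + 1) * L (q + 1) := fun q => by
    have : r ^ (k + 1) * Q = 2 := by rw [hQ]; field_simp
    simp only [hL, pow_succ Q q]
    apply le_of_eq
    linear_combination (-(L₀ * Q ^ q)) * this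
  -- Excluding 1 rules out the factorization N = 1 · N, to which the pigeonhole argument does not
  -- apply.
  set A : Set ℕ := {n | 2 ≤ n ∧ ∀ q, n ∉ removed B r (k + 1) (L q)} with hA
  refine ⟨A, R_isBigO ha.le (by linarith) hC.le fun N hN => ?_, ?_⟩
  · obtain ⟨q, hq⟩ := exists_removed_or_sq_le (B := B) (M := k + 1) hr0
      (fun q => hL₀1.trans (hLge q)) hmono htop hgrow N
    refine ⟨({1} ∪ Finset.Icc 1 N.sqrt) ∪
      (Finset.Icc 1 N).filter (· ∈ removed B r (k + 1) (L q)), fun n hn1 hnN hnA => ?_, ?_⟩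
    · simp only [Finset.mem_union, Finset.mem_singleton, Finset.mem_Icc, Finset.mem_filter]
      by_cases h2 : 2 ≤ n
      · have : ∃ q', n ∈ removed B r (k + 1) (L q') := by
          by_contra hcon
          push Not at hcon
          exact hnA ⟨h2, hcon⟩
        obtain ⟨q', hq'⟩ := this
        rcases hq n hnN q' hq' with h | h
        · exact Or.inl (Or.inr ⟨hn1, Nat.le_sqrt'.2 h⟩)
        · exact Or.inr ⟨⟨hn1, hnN⟩, h⟩
      · left; left; omega
    · have h1 := Finset.card_union_le ({1} ∪ Finset.Icc 1 N.sqrt)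
        ((Finset.Icc 1 N).filter (· ∈ removed B r (k + 1) (L q)))
      have h2 := Finset.card_union_le {1} (Finset.Icc 1 N.sqrt)
      rw [Finset.card_singleton, Nat.card_Icc, Nat.add_sub_cancel] at h2
      have h3 := hsparse (k + 1) (by omega) (L q) (hL₀ _ (hLge q)).1.2 N hN
      have h4 : (N.sqrt : ℝ) ≤ √N := Real.nat_sqrt_le_real_sqrt
      have h5 : ((({1} ∪ Finset.Icc 1 N.sqrt) ∪
        (Finset.Icc 1 N).filter (· ∈ removed B r (k + 1) (L q))).card : ℝ) ≤
        1 + N.sqrt + ((Finset.Icc 1 N).filter (· ∈ removed B r (k + 1) (L q))).card := by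
        exact_mod_cast (by omega)
      linarith
  · refine IsOmega.of_sequence hE0 htop fun q => ?_
    obtain ⟨S, hS, hcard⟩ := (hL₀ _ (hLge q)).1.1
    have hLq : 0 ≤ L q := by linarith [hLge q]
    refine ⟨S, fun N hN => ?_, le_trans ?_ hcard⟩
    · obtain ⟨hN0, hNL, hNw, hNk⟩ := hS N hN
      refine ⟨Nat.one_le_iff_ne_zero.2 hN0, hNL, fun hmem => ?_⟩
      obtain ⟨m, hm, n, hn, hmn⟩ := Set.mem_mul.1 hmem
      rcases mem_removed_of_mul hB0 hr0 (by linarith) hLq (by omega) hN0 hNL hNw hNk hm.1 hn.1 hmn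
        with h | h
      · exact hm.2 q h
      · exact hn.2 q h
    · gcongr

/-! ### The function `W` and its minimum -/

theorem phi_nonneg {x : ℝ} (hx : 0 ≤ x) : 0 ≤ phi x := by
  rcases hx.eq_or_lt with rfl | hx
  · rw [phi_zero]; norm_num
  · have h := Real.one_sub_inv_le_log_of_pos hx
    have : x * (1 - x⁻¹) ≤ x * Real.log x := by gcongr
    rw [mul_sub, mul_inv_cancel₀ hx.ne'] at this
    rw [phi]; linarith

theorem mem_Icc_iff {a B : ℝ} (ha0 : 0 < a) (ha1 : a < 1 / 4) :
    B ∈ Icc 0 (phiInv (4 * a)) ↔ 0 ≤ B ∧ B ≤ 1 ∧ 4 * a ≤ phi B := by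
  have h4a : 4 * a ∈ Icc (0 : ℝ) 1 := ⟨by linarith, by linarith⟩
  have hI := phiInv_mem h4a
  have hφ := phi_phiInv h4a
  constructor
  · rintro ⟨h0, h1⟩
    have hB1 := h1.trans hI.2
    exact ⟨h0, hB1, hφ ▸ phi_strictAntiOn.antitoneOn ⟨h0, hB1⟩ hI h1⟩
  · rintro ⟨h0, h1, h⟩
    exact ⟨h0, (phi_strictAntiOn.le_iff_ge hI ⟨h0, h1⟩).1 (hφ.symm ▸ h)⟩

/-- Compactness: φ(B) ≥ 4a > 0 on the interval, so W is continuous there. -/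
theorem isLeast_K {a : ℝ} (ha0 : 0 < a) (ha1 : a < 1 / 4) :
    IsLeast (W a '' Icc 0 (phiInv (4 * a))) (K a) := by
  have h4a : 4 * a ∈ Icc (0 : ℝ) 1 := ⟨by linarith, by linarith⟩
  have hne : (Icc 0 (phiInv (4 * a))).Nonempty := nonempty_Icc.2 (phiInv_mem h4a).1
  have hpos : ∀ B ∈ Icc 0 (phiInv (4 * a)), phi B ≠ 0 := fun B hB => by
    have := ((mem_Icc_iff ha0 ha1).1 hB).2.2
    linarith
  have hφ := phi_continuous.continuousOn (s := Icc 0 (phiInv (4 * a)))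
  have hφ2 : ContinuousOn (fun B => phi (2 * B)) (Icc 0 (phiInv (4 * a))) :=
    (phi_continuous.comp (continuous_const.mul continuous_id)).continuousOn
  have hcont : ContinuousOn (W a) (Icc 0 (phiInv (4 * a))) := by
    refine ContinuousOn.add (ContinuousOn.div ?_ (continuousOn_const.mul hφ) fun B hB => ?_)
      (continuousOn_const.mul (hφ2.div hφ hpos))
    · refine (hφ.sub (Real.continuous_sqrt.comp_continuousOn ?_)).pow 2
      exact (hφ.pow 2).sub (continuousOn_const.mul hφ)
    · exact mul_ne_zero (by norm_num) (hpos B hB)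
  exact (isCompact_Icc.image_of_continuousOn hcont).isLeast_sInf (hne.image _)

/-- The smaller root of `t ^ 2 - f t + a f`. -/
noncomputable def smallRoot (a f : ℝ) : ℝ := (f - √(f ^ 2 - 4 * a * f)) / 2

theorem W_eq {a B : ℝ} : W a B = smallRoot a (phi B) ^ 2 / phi B + a * (phi (2 * B) / phi B) := by
  rw [W, smallRoot]; congr 1; rw [div_pow]; ring

theorem smallRoot_spec {a f : ℝ} (ha : 0 < a) (hf : 4 * a ≤ f) :
    smallRoot a f ^ 2 = f * (smallRoot a f - a) ∧ a ≤ smallRoot a f ∧ smallRoot a f ≤ 2 * a := by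
  have hf0 : 0 < f := by linarith
  have hD : 0 ≤ f ^ 2 - 4 * a * f := by nlinarith
  have hs := Real.sq_sqrt hD
  have hs0 := Real.sqrt_nonneg (f ^ 2 - 4 * a * f)
  set s := √(f ^ 2 - 4 * a * f) with hsdef
  have h1 : smallRoot a f ^ 2 = f * (smallRoot a f - a) := by
    rw [smallRoot, ← hsdef]; linear_combination hs / 4
  have h2 : a ≤ smallRoot a f := by
    by_contra hlt
    have : f * (smallRoot a f - a) < 0 := mul_neg_of_pos_of_neg hf0 (by linarith)
    nlinarith [sq_nonneg (smallRoot a f)]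
  refine ⟨h1, h2, ?_⟩
  rw [smallRoot, ← hsdef]
  have : f - 4 * a ≤ s := Real.le_sqrt_of_sq_le (by nlinarith)
  linarith

/-- The smaller root is at least a, so the first term of W dominates a²/φ(B) = φ(B) r²; the second
term is φ(2B) r, and φ(2B) r² ≥ 0 is given away. -/
theorem le_W {a B : ℝ} (ha : 0 < a) (hB0 : 0 ≤ B) (haB : 4 * a ≤ phi B) :
    phi B * (a / phi B) ^ 2 + phi (2 * B) * (a / phi B - (a / phi B) ^ 2) ≤ W a B := by
  have hphi : 0 < phi B := by linarith
  have h2 := phi_nonneg (by linarith : 0 ≤ 2 * B)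
  obtain ⟨-, h3, -⟩ := smallRoot_spec ha haB
  have h4 : phi B * (a / phi B) ^ 2 = a ^ 2 / phi B := by field_simp
  have h5 : a ^ 2 / phi B ≤ smallRoot a (phi B) ^ 2 / phi B := by gcongr
  have h6 : 0 ≤ phi (2 * B) * (a / phi B) ^ 2 := by positivity
  have h7 : a * (phi (2 * B) / phi B) = phi (2 * B) * (a / phi B) := by ring
  rw [W_eq, h4, h7]
  linarith

theorem exists_set {a ε : ℝ} (ha0 : 0 < a) (ha1 : a < 1 / 4) (hε : 0 < ε) :
    ∃ A : Set ℕ, (fun x : ℝ => R x A) =O[atTop] (fun x : ℝ => (Real.log x) ^ (-a)) ∧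
      IsOmega (fun x : ℝ => R x (A * A)) (fun x : ℝ => (Real.log x) ^ (-K a - ε)) := by
  obtain ⟨B, hB, hBK⟩ := (isLeast_K ha0 ha1).1
  obtain ⟨hB0, hB1, haB⟩ := (mem_Icc_iff ha0 ha1).1 hB
  have h1 := le_W ha0 hB0 haB
  have hphi : 0 < phi B := by linarith
  have hr1 : a / phi B ≤ 1 := by rw [div_le_one hphi]; linarith
  have hr0 : 0 < a / phi B := by positivity
  have h2 : 0 ≤ phi B * (a / phi B) ^ 2 + phi (2 * B) * (a / phi B - (a / phi B) ^ 2) := by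
    have := phi_nonneg (by linarith : 0 ≤ 2 * B)
    have : 0 ≤ a / phi B - (a / phi B) ^ 2 := by nlinarith
    positivity
  have h3 := exists_set_of_phi ha0 hB0 hB1 haB (E := K a + ε) (by linarith) (by linarith)
  rwa [neg_add'] at h3

theorem psi_le_K {a : ℝ} (ha0 : 0 < a) (ha1 : a < 1 / 4) : psi a ≤ (K a : EReal) := by
  refine sSup_le ?_
  rintro _ ⟨b, ⟨-, hb⟩, rfl⟩
  rw [EReal.coe_le_coe_iff]
  by_contra hlt
  push Not at hlt
  -- Half the gap: the exponent K + ε is then still smaller than b by ε, so the O-bound contradicts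
  -- the Ω-bound.
  set ε := (b - K a) / 2 with hε
  obtain ⟨A, hA1, c, hc, hA2⟩ := exists_set ha0 ha1 (by linarith : 0 < ε)
  obtain ⟨C, hC, hbd⟩ := (hb A hA1).exists_pos
  have hdec : Tendsto (fun x : ℝ => Real.log x ^ (-ε)) atTop (𝓝 0) :=
    (tendsto_rpow_neg_atTop (by linarith)).comp Real.tendsto_log_atTop
  have hsmall := hdec.eventually_lt_const (div_pos hc hC)
  obtain ⟨x, hx, ⟨hx1, hx2⟩, hx3⟩ :=
    (hA2.and_eventually ((hbd.bound.and hsmall).and (eventually_gt_atTop 1))).exists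
  have hlog : 0 < Real.log x := Real.log_pos hx3
  have hp : 0 < Real.log x ^ (-K a - ε) := Real.rpow_pos_of_pos hlog _
  have h1 : Real.log x ^ (-b) = Real.log x ^ (-K a - ε) * Real.log x ^ (-ε) := by
    rw [← Real.rpow_add hlog]; congr 1; rw [hε]; ring
  rw [Real.norm_eq_abs, Real.norm_eq_abs, abs_of_pos (Real.rpow_pos_of_pos hlog _), h1] at hx1
  rw [abs_of_pos hp] at hx
  rw [lt_div_iff₀ hC] at hx2
  have h2 : c * Real.log x ^ (-K a - ε) ≤
      (Real.log x ^ (-ε) * C) * Real.log x ^ (-K a - ε) := by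
    refine hx.trans (hx1.trans (le_of_eq (by ring)))
  exact absurd (le_of_mul_le_mul_right h2 hp) (not_le.2 hx2)


/-! ### The range where K(a) < a, and small a. -/

/-- With f = φ(B), g = φ(2B) and t the smaller root, t²/f = t - a, so W < a means t < T = 2a - ag/f.
The hypothesis says that the quadratic is negative at T, which places T beyond t. -/
theorem W_lt_of_lt {a B : ℝ} (ha : 0 < a) (haB : 4 * a ≤ phi B)
    (h : a * (2 * phi B - phi (2 * B)) ^ 2 < phi B ^ 2 * (phi B - phi (2 * B))) : W a B < a := by
  have hf : 0 < phi B := by linarith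
  obtain ⟨h1, -, -⟩ := smallRoot_spec ha haB
  set f := phi B
  set g := phi (2 * B)
  set T := a * (2 * f - g) / f with hT
  have hT2 : T ^ 2 < f * (T - a) := by
    have e1 : T ^ 2 = a * (a * (2 * f - g) ^ 2) / f ^ 2 := by rw [hT, div_pow]; ring
    have e2 : f * (T - a) = a * (f - g) := by rw [hT]; field_simp; ring
    rw [e1, e2, div_lt_iff₀ (by positivity)]
    nlinarith
  have h2 : smallRoot a f < T := by
    have : f - 2 * T < √(f ^ 2 - 4 * a * f) := Real.lt_sqrt_of_sq_lt (by nlinarith)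
    rw [smallRoot]; linarith
  have h3 : smallRoot a f ^ 2 / f = smallRoot a f - a := by rw [h1]; field_simp
  have h4 : T = 2 * a - a * (g / f) := by rw [hT]; field_simp
  rw [W_eq]
  change smallRoot a f ^ 2 / f + a * (g / f) < a
  rw [h3]
  linarith

/-- Since 4/33 = 1/(8 · 33/32), this and log 2 evaluate φ at 4/33 and 8/33. -/
theorem log_33_div_32_bounds :
    0.030771657 < Real.log (33 / 32) ∧ Real.log (33 / 32) < 0.03077166 := by
  have h := Real.abs_log_sub_add_sum_range_le (x := -(1 / 32)) (by rw [abs_neg]; norm_num) 5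
  rw [show (1 : ℝ) - -(1 / 32) = 33 / 32 by norm_num, abs_neg,
    abs_of_pos (by norm_num : (0 : ℝ) < 1 / 32)] at h
  norm_num [Finset.sum_range_succ] at h
  rw [abs_le] at h
  constructor <;> linarith [h.1, h.2]

theorem K_lt {a : ℝ} (ha0 : 0 < a) (ha1 : a ≤ 0.11717) : K a < a := by
  have ha4 : a < 1 / 4 := by norm_num at ha1 ⊢; linarith
  obtain ⟨l1, l2⟩ := log_33_div_32_bounds
  have t1 := Real.log_two_gt_d9
  have t2 := Real.log_two_lt_d9
  have e1 : Real.log (4 / 33) = -3 * Real.log 2 - Real.log (33 / 32) := by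
    rw [show (4 / 33 : ℝ) = (2 ^ 3 * (33 / 32))⁻¹ by norm_num, Real.log_inv,
      Real.log_mul (by norm_num) (by norm_num), Real.log_pow]
    push_cast; ring
  have e2 : Real.log (2 * (4 / 33)) = -2 * Real.log 2 - Real.log (33 / 32) := by
    rw [Real.log_mul (by norm_num) (by norm_num), e1]; ring
  have hf : phi (4 / 33) = 4 / 33 * (-3 * Real.log 2 - Real.log (33 / 32)) - 4 / 33 + 1 := by
    rw [phi, e1]
  have hg : phi (2 * (4 / 33)) =
      8 / 33 * (-2 * Real.log 2 - Real.log (33 / 32)) - 8 / 33 + 1 := by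
    rw [phi, e2]; ring
  have f1 : 0.6230044576 ≤ phi (4 / 33) := by rw [hf]; linarith
  have f2 : phi (4 / 33) ≤ 0.6230044636 := by rw [hf]; linarith
  have g1 : 0.4140445983 ≤ phi (2 * (4 / 33)) := by rw [hg]; linarith
  have g2 : phi (2 * (4 / 33)) ≤ 0.4140446043 := by rw [hg]; linarith
  have haB : 4 * a ≤ phi (4 / 33) := by norm_num at ha1 ⊢; linarith
  -- At B = 4/33 and a = 0.11717 the criterion holds with a relative margin below 10^(-4), hence the
  -- many digits above.
  refine lt_of_le_of_lt ((isLeast_K ha0 ha4).2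
    ⟨4 / 33, (mem_Icc_iff ha0 ha4).2 ⟨by norm_num, by norm_num, haB⟩, rfl⟩) ?_
  refine W_lt_of_lt ha0 haB ?_
  set f := phi (4 / 33)
  set g := phi (2 * (4 / 33))
  calc a * (2 * f - g) ^ 2 ≤ 0.11717 * (2 * 0.6230044636 - 0.4140445983) ^ 2 := by
        have : 0 ≤ 2 * f - g := by linarith
        gcongr
    _ < 0.6230044576 ^ 2 * (0.6230044576 - 0.4140446043) := by norm_num
    _ ≤ f ^ 2 * (f - g) := by gcongr

theorem phi_one_half : phi (1 / 2) = (1 - Real.log 2) / 2 := by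
  rw [phi, one_div, Real.log_inv]; ring

/-- At B = 1/2 the second term of W vanishes, as φ(1) = 0. With f = φ(1/2), the root satisfies t = a
+ t²/f and t ≤ 2a, so t ≤ a + 4a²/f; squaring and using 4a ≤ f gives the cubic error. -/
theorem K_le_of_small {a : ℝ} (ha0 : 0 < a) (ha : 4 * a ≤ phi (1 / 2)) :
    K a ≤ 2 * a ^ 2 / (1 - Real.log 2) + 12 * a ^ 3 / phi (1 / 2) ^ 2 := by
  have hf0 : 0 < phi (1 / 2) := by linarith
  have hf1 : phi (1 / 2) < 1 := by
    rw [phi_one_half]; linarith [Real.log_two_gt_d9]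
  have ha4 : a < 1 / 4 := by linarith
  refine ((isLeast_K ha0 ha4).2
    ⟨1 / 2, (mem_Icc_iff ha0 ha4).2 ⟨by norm_num, by norm_num, ha⟩, rfl⟩).trans ?_
  obtain ⟨h1, h2, h3⟩ := smallRoot_spec ha0 ha
  have hW : W a (1 / 2) = smallRoot a (phi (1 / 2)) ^ 2 / phi (1 / 2) := by
    rw [W_eq, show (2 : ℝ) * (1 / 2) = 1 by norm_num, phi_one]; ring
  have hden : 2 * a ^ 2 / (1 - Real.log 2) = a ^ 2 / phi (1 / 2) := by
    have : 1 - Real.log 2 = 2 * phi (1 / 2) := by rw [phi_one_half]; ring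
    rw [this]; field_simp
  rw [hW, hden]
  set f := phi (1 / 2)
  set t := smallRoot a f
  have h4 : t * f ≤ a * f + 4 * a ^ 2 := by nlinarith
  have h5 : (t * f) ^ 2 ≤ (a * f + 4 * a ^ 2) ^ 2 := by
    have : 0 ≤ t := by linarith
    gcongr
  have h6 : t ^ 2 * f ^ 2 ≤ (a ^ 2 * f + 12 * a ^ 3) * f := by
    have : 16 * a ^ 4 ≤ 4 * a ^ 3 * f := by
      have : 0 < a ^ 3 := by positivity
      nlinarith
    nlinarith
  have h7 : a ^ 2 / f + 12 * a ^ 3 / f ^ 2 = (a ^ 2 * f + 12 * a ^ 3) / f ^ 2 := by field_simp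
  rw [h7, div_le_div_iff₀ hf0 (by positivity)]
  exact h6

theorem exists_isLittleO_K : ∃ h : ℝ → ℝ, h =o[𝓝[>] 0] (fun a : ℝ => a ^ 2) ∧
    ∀ a : ℝ, 0 < a → a < 1 / 4 → K a ≤ 2 * a ^ 2 / (1 - Real.log 2) + h a := by
  have hf0 : 0 < phi (1 / 2) := by
    rw [phi_one_half]; linarith [Real.log_two_lt_d9]
  -- Truncation at 0, because only an upper bound for K is available.
  refine ⟨fun a => max 0 (K a - 2 * a ^ 2 / (1 - Real.log 2)), ?_, fun a _ _ => ?_⟩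
  · refine IsLittleO.of_bound fun c hc => ?_
    have hpos : 0 < min (phi (1 / 2) / 4) (c * phi (1 / 2) ^ 2 / 12) := by positivity
    filter_upwards [Ioo_mem_nhdsGT hpos] with a ha
    have h1 := ha.2.le.trans (min_le_left _ _)
    have h2 := ha.2.le.trans (min_le_right _ _)
    have h3 := K_le_of_small ha.1 (by linarith)
    have h4 : 12 * a ^ 3 / phi (1 / 2) ^ 2 ≤ c * a ^ 2 := by
      rw [div_le_iff₀ (by positivity)]
      have : 0 < a ^ 2 := pow_pos ha.1 2
      nlinarith
    rw [Real.norm_of_nonneg (le_max_left _ _), Real.norm_of_nonneg (by positivity)]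
    exact max_le (by positivity) (by linarith)
  · have := le_max_right 0 (K a - 2 * a ^ 2 / (1 - Real.log 2))
    linarith

end ProductSetDensity

open ProductSetDensity in
theorem theorem1p1 :
    -- the minimum defining `K a` is attained
    (∀ a : ℝ, 0 < a → a < 1 / 4 → IsLeast (W a '' Icc 0 (phiInv (4 * a))) (K a)) ∧
    -- the optimal exponent is at most `K a`
    (∀ a : ℝ, 0 < a → a < 1 / 4 → psi a ≤ (K a : EReal)) ∧
    -- the same bound, witnessed by sets of density one
    (∀ a : ℝ, 0 < a → a < 1 / 4 → ∀ ε : ℝ, 0 < ε → ∃ A : Set ℕ,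
      Tendsto (fun x : ℝ => R x A) atTop (𝓝 0) ∧
      (fun x : ℝ => R x A) =O[atTop] (fun x : ℝ => (Real.log x) ^ (-a)) ∧
      IsOmega (fun x : ℝ => R x (A * A)) (fun x : ℝ => (Real.log x) ^ (-K a - ε))) ∧
    (∀ a : ℝ, 0 < a → a ≤ 0.11717 → K a < a) ∧
    (∃ h : ℝ → ℝ, h =o[𝓝[>] 0] (fun a : ℝ => a ^ 2) ∧
      ∀ a : ℝ, 0 < a → a < 1 / 4 → K a ≤ 2 * a ^ 2 / (1 - Real.log 2) + h a) := by
  refine ⟨fun a h0 h1 => isLeast_K h0 h1, fun a h0 h1 => psi_le_K h0 h1,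
    fun a h0 h1 ε hε => ?_, fun a h0 h1 => K_lt h0 h1, exists_isLittleO_K⟩
  obtain ⟨A, hA, hAA⟩ := exists_set h0 h1 hε
  exact ⟨A, R_tendsto_zero h0 hA, hA, hAA⟩
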